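/- Let $M$ be a smooth manifold of dimension $n=2m$, $m\ge 2$, with a smooth pseudo-Riemannian metric $g$ of arbitrary signature, Levi-Civita connection $\nabla$ and Weyl tensor $C$. Let $\phi$ be a conformal Killing--Yano tensor, i.e. a smooth real $2$-form for which there are a $3$-form $\tau$ and a $1$-form $K$ with $$\nabla_c\phi_{ab}=\tau_{cab}+\frac{2}{n-1}\,g_{c[a}K_{b]} .$$ Assume that at every point $\phi$ is non-degenerate and the endomorphism $\phi^a{}_b=g^{ac}\phi_{cb}$ has $2m$ distinct complex eigenvalues. A *diagonalising null frame* at $p$ is a basis $\{\theta^\mu,\theta_\mu\}_{\mu=1}^m$ of the complexified cotangent space with $g=\sum_\mu(\theta^\mu\otimes\theta_\mu+\theta_\mu\otimes\theta^\mu)$ and $\phi=\sum_\mu\lambda_\mu(\theta^\mu\otimes\theta_\mu-\theta_\mu\otimes\theta^\mu)$; its dual basis is $\{V_a\}=\{V_\mu,V^\mu\}$. A non-zero (complex) null vector $\ell$ at $p$ is a *Weyl aligned null direction* (WAND) if $C(\ell,X,\ell,Y)=0$ for all $X,Y\perp\ell$. For a null pair $\ell,k$ with $g(\ell,k)=1$,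 *$C$ has only components of boost weight zero relative to $(\ell,k)$* if for all $X,Y,Z$ orthogonal to $\ell$ and $k$ $$C(\ell,X,\ell,Y)=C(\ell,k,\ell,X)=C(\ell,X,Y,Z)=0,$$ and the same holds with $\ell$ and $k$ exchanged. If $\ell,k$ can be chosen real and $C_p\neq0$, then $C$ is *of type D* at $p$. 1. (Any signature.) Let $N\subset M$ be the set of points at which every non-zero eigenvalue of the endomorphism induced by $\phi$ on $2$-forms is simple: if $\alpha\ne\beta$ and $\gamma\neq\delta$ are eigenvalues of $\phi^a{}_b$ with $\alpha+\beta=\gamma+\delta\ne0$, then $\{\alpha,\beta\}=\{\gamma,\delta\}$. At every point of the closure of $N$ and for every diagonalising null frame, each of the $2m$ basis vectors $V_a$ is a WAND, and for each $\mu$ the Weyl tensor has only components of boost weight zero relative to $(V_\mu,V^\mu)$. 2. (Lorentzian signature; no further assumption on the eigenvalues.) At every point $p$ where $g$ is Lorentzian, each diagonalising null frame contains a pair $V_\mu,V^\mu$ of (multiples of) real null vectors relative to which $C$ has only components of boost weight zero; every frame vector $V_a$ that is a multiple of a real vector is a WAND; and $C$ is of type D at $p$ or $C_p=0$. -/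

import Mathlib

open scoped Manifold ContDiff

noncomputable section

namespace CKY

/-- Coordinate space `ℝⁿ`, the model of an `n`-dimensional manifold. -/
abbrev Coord (n : ℕ) := EuclideanSpace ℝ (Fin n)

/-! ### Metrics and two-forms on a smooth manifold, and their components in a chart -/

section Manifold

variable {n : ℕ} {M : Type*} [TopologicalSpace M] [ChartedSpace (Coord n) M]

/-- The coordinate vector `∂/∂xⁱ` of the chart `e`, at the point with coordinates `x`. -/
def coordVec (e : OpenPartialHomeomorph M (Coord n)) (x : Coord n) (i : Fin n) :
    TangentSpace (𝓡 n) (e.symm x) :=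
  mfderiv (𝓡 n) (𝓡 n) e.symm x
    (show TangentSpace (𝓡 n) x from EuclideanSpace.single i (1 : ℝ))

/-- The components `B(∂ᵢ, ∂ⱼ)` in the chart `e` of a field `B` of bilinear forms on the tangent
spaces of `M`, as a matrix-valued function of the coordinates (meaningful on `e.target`). -/
def comp (B : ∀ p : M, LinearMap.BilinForm ℝ (TangentSpace (𝓡 n) p))
    (e : OpenPartialHomeomorph M (Coord n)) (x : Coord n) : Matrix (Fin n) (Fin n) ℝ :=
  Matrix.of fun i j => B (e.symm x) (coordVec e x i) (coordVec e x j)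

end Manifold

/-- A smooth pseudo-Riemannian metric (of arbitrary signature) on the `n`-manifold `M`. -/
structure Metric (n : ℕ) (M : Type*) [TopologicalSpace M] [ChartedSpace (Coord n) M] where
  form : ∀ p : M, LinearMap.BilinForm ℝ (TangentSpace (𝓡 n) p)
  symm : ∀ (p : M) (X Y : TangentSpace (𝓡 n) p), form p X Y = form p Y X
  nondeg : ∀ (p : M) (X : TangentSpace (𝓡 n) p), (∀ Y, form p X Y = 0) → X = 0
  smooth : ∀ e ∈ atlas (Coord n) M, ∀ i j : Fin n,
    ContDiffOn ℝ ∞ (fun x => comp form e x i j) e.target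

/-- A smooth (real) differential `2`-form on the `n`-manifold `M`. -/
structure TwoForm (n : ℕ) (M : Type*) [TopologicalSpace M] [ChartedSpace (Coord n) M] where
  form : ∀ p : M, LinearMap.BilinForm ℝ (TangentSpace (𝓡 n) p)
  alt : ∀ (p : M) (X : TangentSpace (𝓡 n) p), form p X X = 0
  smooth : ∀ e ∈ atlas (Coord n) M, ∀ i j : Fin n,
    ContDiffOn ℝ ∞ (fun x => comp form e x i j) e.target

/-! ### Levi-Civita connection and curvature in coordinates

Here `G` is the matrix of components of a metric, as a function of the coordinates. -/

section Local

variable {n : ℕ}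

/-- The partial derivative `∂ᵢ f` at `x`. -/
def pderiv (i : Fin n) (f : Coord n → ℝ) (x : Coord n) : ℝ :=
  fderiv ℝ f x (EuclideanSpace.single i (1 : ℝ))

/-- The Christoffel symbol `Γᵏᵢⱼ` of the Levi-Civita connection. -/
def christoffel (G : Coord n → Matrix (Fin n) (Fin n) ℝ) (k i j : Fin n) (x : Coord n) : ℝ :=
  (1 / 2) * ∑ l, (G x)⁻¹ k l *
    (pderiv i (fun y => G y l j) x + pderiv j (fun y => G y l i) x - pderiv l (fun y => G y i j) x)

/-- The components `(∇φ)_{cab} = ∇_c φ_{ab}` of the Levi-Civita covariant derivative of a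
covariant `2`-tensor with components `Φ`. -/
def covDeriv (G Φ : Coord n → Matrix (Fin n) (Fin n) ℝ) (c a b : Fin n) (x : Coord n) : ℝ :=
  pderiv c (fun y => Φ y a b) x
    - ∑ k, christoffel G k c a x * Φ x k b - ∑ k, christoffel G k c b x * Φ x a k

/-- The Riemann tensor `Rᵏ_{lij}`, the `∂ₖ`-component of `R(∂ᵢ, ∂ⱼ)∂ₗ`. -/
def riemannUp (G : Coord n → Matrix (Fin n) (Fin n) ℝ) (k l i j : Fin n) (x : Coord n) : ℝ :=
  pderiv i (christoffel G k j l) x - pderiv j (christoffel G k i l) x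
    + ∑ r, (christoffel G k i r x * christoffel G r j l x
        - christoffel G k j r x * christoffel G r i l x)

/-- The Riemann tensor `R_{abcd} = g_{ak} Rᵏ_{bcd}`. -/
def riemann (G : Coord n → Matrix (Fin n) (Fin n) ℝ) (a b c d : Fin n) (x : Coord n) : ℝ :=
  ∑ k, G x a k * riemannUp G k b c d x

/-- The Ricci tensor `R_{bd} = Rᵏ_{bkd}`. -/
def ricci (G : Coord n → Matrix (Fin n) (Fin n) ℝ) (b d : Fin n) (x : Coord n) : ℝ :=
  ∑ k, riemannUp G k b k d x

/-- The scalar curvature. -/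
def scalarCurv (G : Coord n → Matrix (Fin n) (Fin n) ℝ) (x : Coord n) : ℝ :=
  ∑ b, ∑ d, (G x)⁻¹ b d * ricci G b d x

/-- The Weyl conformal tensor `C_{abcd}` (for `n ≥ 3`). -/
def weyl (G : Coord n → Matrix (Fin n) (Fin n) ℝ) (x : Coord n) (a b c d : Fin n) : ℝ :=
  riemann G a b c d x
    - 1 / ((n : ℝ) - 2) * (G x a c * ricci G b d x - G x a d * ricci G b c x
        - G x b c * ricci G a d x + G x b d * ricci G a c x)
    + scalarCurv G x / (((n : ℝ) - 1) * ((n : ℝ) - 2)) * (G x a c * G x b d - G x a d * G x b c)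

/-- The conformal Killing-Yano equation at `x`:
`∇_c φ_{ab} = τ_{cab} + (2 / (n - 1)) g_{c[a} K_{b]}` for a `3`-form `τ` and a `1`-form `K`
(which are then determined by the equation). -/
def CKYEquationAt (G Φ : Coord n → Matrix (Fin n) (Fin n) ℝ) (x : Coord n) : Prop :=
  ∃ (τ : Fin n → Fin n → Fin n → ℝ) (K : Fin n → ℝ),
    (∀ c a b, τ c a b = -τ a c b) ∧ (∀ c a b, τ c a b = -τ c b a) ∧
    ∀ c a b, covDeriv G Φ c a b x
      = τ c a b + 1 / ((n : ℝ) - 1) * (G x c a * K b - G x c b * K a)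

end Local

/-- `φ` is a conformal Killing-Yano tensor (conformal Killing `2`-form) of `(M, g)`. -/
def IsConformalKillingYano {n : ℕ} {M : Type*} [TopologicalSpace M] [ChartedSpace (Coord n) M]
    (g : Metric n M) (φ : TwoForm n M) : Prop :=
  ∀ e ∈ atlas (Coord n) M, ∀ x ∈ e.target, CKYEquationAt (comp g.form e) (comp φ.form e) x

/-! ### Algebra in one (complexified) tangent space

From here on `G` and `Φ` are the component matrices at one point of a metric and of a `2`-form, `W`
are the components of the Weyl tensor there, and complexified tangent vectors and covectors are
given by their components `Fin n → ℂ`. -/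

section Pointwise

variable {n : ℕ}

/-- The complex bilinear extension of a real bilinear form. -/
def bilin (G : Matrix (Fin n) (Fin n) ℝ) (u v : Fin n → ℂ) : ℂ :=
  ∑ i, ∑ j, (G i j : ℂ) * u i * v j

/-- The complex multilinear extension of a real covariant `4`-tensor. -/
def quad (W : Fin n → Fin n → Fin n → Fin n → ℝ) (u v w z : Fin n → ℂ) : ℂ :=
  ∑ i, ∑ j, ∑ k, ∑ l, (W i j k l : ℂ) * u i * v j * w k * z l

/-- The (complex) eigenvalues of the endomorphism `φᵃ_b = gᵃᶜ φ_{cb}`. -/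
def eigenvalues (G Φ : Matrix (Fin n) (Fin n) ℝ) : Set ℂ :=
  spectrum ℂ ((G⁻¹ * Φ).map (fun r : ℝ => (r : ℂ)))

/-- `φ` is non-degenerate and has `n` distinct eigenvalues. -/
def NondegenerateDistinct (G Φ : Matrix (Fin n) (Fin n) ℝ) : Prop :=
  Φ.det ≠ 0 ∧ (eigenvalues G Φ).ncard = n

/-- The non-zero eigenvalues `α + β` (`α ≠ β` eigenvalues of `φ`) of the induced endomorphism of
the space of `2`-forms are simple. -/
def SimpleOnTwoForms (G Φ : Matrix (Fin n) (Fin n) ℝ) : Prop :=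
  ∀ α ∈ eigenvalues G Φ, ∀ β ∈ eigenvalues G Φ, ∀ γ ∈ eigenvalues G Φ, ∀ δ ∈ eigenvalues G Φ,
    α ≠ β → γ ≠ δ → α + β ≠ 0 → α + β = γ + δ → (α = γ ∧ β = δ) ∨ (α = δ ∧ β = γ)

/-- A null coframe in which `φ` is diagonal, with its dual frame. The index `Sum.inl μ` stands for
`θ^μ` and the dual vector `V_μ`; the index `Sum.inr μ` stands for `θ_μ` and the dual vector `V^μ`. -/
structure NullDiagonalFrame (m : ℕ) (G Φ : Matrix (Fin (2 * m)) (Fin (2 * m)) ℝ) where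
  θ : Fin m ⊕ Fin m → Fin (2 * m) → ℂ
  V : Fin m ⊕ Fin m → Fin (2 * m) → ℂ
  eig : Fin m → ℂ
  dual : ∀ a b, ∑ i, θ a i * V b i = if a = b then 1 else 0
  metric_eq : ∀ i j, (G i j : ℂ) =
    ∑ μ, (θ (Sum.inl μ) i * θ (Sum.inr μ) j + θ (Sum.inr μ) i * θ (Sum.inl μ) j)
  form_eq : ∀ i j, (Φ i j : ℂ) =
    ∑ μ, eig μ * (θ (Sum.inl μ) i * θ (Sum.inr μ) j - θ (Sum.inr μ) i * θ (Sum.inl μ) j)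

/-- `l` is a Weyl aligned null direction: `l` is null and non-zero and the components
`C(l, X, l, Y)`, with `X`, `Y` orthogonal to `l`, of leading boost weight vanish. -/
def IsWAND (G : Matrix (Fin n) (Fin n) ℝ) (W : Fin n → Fin n → Fin n → Fin n → ℝ)
    (l : Fin n → ℂ) : Prop :=
  l ≠ 0 ∧ bilin G l l = 0 ∧
    ∀ X Y, bilin G l X = 0 → bilin G l Y = 0 → quad W l X l Y = 0

/-- The components of boost weight `2` and `1` relative to the null pair `l`, `k` vanish. -/
def NoPositiveBoost (G : Matrix (Fin n) (Fin n) ℝ) (W : Fin n → Fin n → Fin n → Fin n → ℝ)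
    (l k : Fin n → ℂ) : Prop :=
  ∀ X Y Z, bilin G l X = 0 → bilin G k X = 0 → bilin G l Y = 0 → bilin G k Y = 0 →
    bilin G l Z = 0 → bilin G k Z = 0 →
    quad W l X l Y = 0 ∧ quad W l k l X = 0 ∧ quad W l X Y Z = 0

/-- `l`, `k` is a normalised null pair relative to which all components of `C` of non-zero boost
weight vanish. -/
def IsTypeDPair (G : Matrix (Fin n) (Fin n) ℝ) (W : Fin n → Fin n → Fin n → Fin n → ℝ)
    (l k : Fin n → ℂ) : Prop :=
  bilin G l l = 0 ∧ bilin G k k = 0 ∧ bilin G l k = 1 ∧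
    NoPositiveBoost G W l k ∧ NoPositiveBoost G W k l

/-- A real vector regarded as a complexified one. -/
def toComplex (l : Fin n → ℝ) : Fin n → ℂ := fun i => (l i : ℂ)

/-- `v` spans the complexification of a real direction. -/
def IsRealDirection (v : Fin n → ℂ) : Prop :=
  ∃ (c : ℂ) (l : Fin n → ℝ), c ≠ 0 ∧ l ≠ 0 ∧ v = c • toComplex l

/-- The Weyl tensor is of type D: it is non-zero, and it has only components of boost weight zero
relative to some pair of real null vectors. -/
def IsTypeD (G : Matrix (Fin n) (Fin n) ℝ) (W : Fin n → Fin n → Fin n → Fin n → ℝ) : Prop :=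
  W ≠ 0 ∧ ∃ l k : Fin n → ℝ, IsTypeDPair G W (toComplex l) (toComplex k)

/-- Lorentzian signature, in either sign convention. -/
def IsLorentzian (G : Matrix (Fin n) (Fin n) ℝ) : Prop :=
  ∃ (s : ℝ) (P : Matrix (Fin n) (Fin n) ℝ), (s = 1 ∨ s = -1) ∧ P.det ≠ 0 ∧
    P.transpose * G * P = s • Matrix.diagonal (fun i : Fin n => if i.val = 0 then (1 : ℝ) else -1)

end Pointwise

end CKY

end

/-! The endomorphism A = g⁻¹φ lies in so(g), and its derivation action annihilates the Weyl tensor: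
A·C = 0 (`tensorAct_weyl`). Commuting second covariant derivatives of φ gives the curvature acting
on φ, that is, A acting on one index pair of R, in terms of ∇τ and ∇K. Adding the two index pairs
gives A·R = dτ + g ⊙ N, with ⊙ the Kulkarni-Nomizu product and N symmetric. Since A preserves g, the
same holds for A·C with another N; but A·C also inherits the Bianchi identity and the vanishing
traces of C. The first kills the four-form, the second kills N.

Evaluated on eigenvectors of A, invariance reads (α + β + γ + δ) C(u, v, w, z) = 0 (`quad_eigen`).
The frame vectors are eigenvectors with eigenvalues ∓λ_μ, dual ones having opposite eigenvalues. All
claims reduce to `Aligned`: C(V_a, V_b, V_c, V_d) = 0 whenever none of b, c, d is dual to a. The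
remaining components C(ℓ, k, ℓ, X) vanish by `quad_eigen` alone.

On N, a vanishing eigenvalue sum means α + β = (-γ) + (-δ) ≠ 0, so simplicity makes α equal to -γ or
-δ, which is excluded; repeated entries in a pair are killed by antisymmetry
(`quad_eq_zero_of_simple`). At a limit point of N, unit eigenvectors at nearby points of N
subconverge to non-zero multiples of the frame vectors, and the vanishing passes to the limit
(`aligned_of_mem_closure`).

In Lorentzian signature orthogonal null vectors are proportional. An eigenvector whose eigenvalue
has non-zero real part is orthogonal to its conjugate, hence real up to a factor; two such vectors
must belong to one dual pair. Such a pair exists, since otherwise the Hermitian form g(u, ū) would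
be diagonal in the frame without a timelike entry (`exists_re_ne_zero`). Real parts alone then
prevent the eigenvalue sums from vanishing, whatever the other eigenvalues are. -/

noncomputable section

namespace CKY

/-! ### Partial derivatives of functions and of matrix-valued functions -/

section Calculus

variable {n : ℕ} {U : Set (Coord n)} {f h : Coord n → ℝ} {x : Coord n}

theorem contDiffOn_pderiv (hU : IsOpen U) (hf : ContDiffOn ℝ ∞ f U) (i : Fin n) :
    ContDiffOn ℝ ∞ (pderiv i f) U :=
  (hf.fderiv_of_isOpen hU (by simp)).clm_apply contDiffOn_const

theorem ContDiffOn.differentiableAt_of_isOpen (hU : IsOpen U) (hf : ContDiffOn ℝ ∞ f U)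
    (hx : x ∈ U) : DifferentiableAt ℝ f x :=
  (hf.contDiffAt (hU.mem_nhds hx)).differentiableAt (by simp)

theorem pderiv_comm (hU : IsOpen U) (hf : ContDiffOn ℝ ∞ f U) (hx : x ∈ U) (i j : Fin n) :
    pderiv i (pderiv j f) x = pderiv j (pderiv i f) x := by
  have hc := hf.contDiffAt (hU.mem_nhds hx)
  have hd : DifferentiableAt ℝ (fderiv ℝ f) x :=
    (hc.fderiv_right (m := 1) (by norm_cast)).differentiableAt (by simp)
  have key : ∀ k l : Fin n, pderiv k (pderiv l f) x
      = fderiv ℝ (fderiv ℝ f) x (EuclideanSpace.single k 1) (EuclideanSpace.single l 1) := by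
    intro k l
    have := fderiv_clm_apply hd (differentiableAt_const (EuclideanSpace.single l (1 : ℝ)))
    simp only [pderiv]
    change (fderiv ℝ (fun y => (fderiv ℝ f y) (EuclideanSpace.single l 1)) x) _ = _
    rw [this]
    simp
  rw [key, key]
  exact hc.isSymmSndFDerivAt (by simp; norm_cast) _ _

theorem pderiv_congr (hU : IsOpen U) (hx : x ∈ U) (hfh : ∀ y ∈ U, f y = h y) (i : Fin n) :
    pderiv i f x = pderiv i h x := by
  have : f =ᶠ[nhds x] h := Filter.eventuallyEq_of_mem (hU.mem_nhds hx) hfh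
  simp only [pderiv, this.fderiv_eq]

theorem pderiv_const (c : ℝ) (i : Fin n) : pderiv i (fun _ => c) x = 0 := by
  simp [pderiv]

theorem pderiv_add (hf : DifferentiableAt ℝ f x) (hh : DifferentiableAt ℝ h x) (i : Fin n) :
    pderiv i (fun y => f y + h y) x = pderiv i f x + pderiv i h x := by
  simp [pderiv, fderiv_fun_add hf hh]

theorem pderiv_sub (hf : DifferentiableAt ℝ f x) (hh : DifferentiableAt ℝ h x) (i : Fin n) :
    pderiv i (fun y => f y - h y) x = pderiv i f x - pderiv i h x := by
  simp [pderiv, fderiv_fun_sub hf hh]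

theorem pderiv_neg (i : Fin n) : pderiv i (fun y => - f y) x = - pderiv i f x := by
  simp [pderiv, fderiv_fun_neg]

theorem pderiv_mul (hf : DifferentiableAt ℝ f x) (hh : DifferentiableAt ℝ h x) (i : Fin n) :
    pderiv i (fun y => f y * h y) x = pderiv i f x * h x + f x * pderiv i h x := by
  simp [pderiv, fderiv_fun_mul hf hh]; ring

theorem pderiv_const_mul (hf : DifferentiableAt ℝ f x) (c : ℝ) (i : Fin n) :
    pderiv i (fun y => c * f y) x = c * pderiv i f x := by
  rw [pderiv_mul (differentiableAt_const c) hf, pderiv_const]; ring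

theorem pderiv_sum {ι : Type*} (s : Finset ι) {F : ι → Coord n → ℝ}
    (hF : ∀ k ∈ s, DifferentiableAt ℝ (F k) x) (i : Fin n) :
    pderiv i (fun y => ∑ k ∈ s, F k y) x = ∑ k ∈ s, pderiv i (F k) x := by
  simp [pderiv, fderiv_fun_sum hF]

/-- Entrywise partial derivative of a matrix-valued function. -/
def mderiv (i : Fin n) (B : Coord n → Matrix (Fin n) (Fin n) ℝ) (x : Coord n) :
    Matrix (Fin n) (Fin n) ℝ :=
  Matrix.of fun a b => pderiv i (fun y => B y a b) x

/-- Entrywise smoothness of a matrix-valued function. -/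
def MSmooth (U : Set (Coord n)) (B : Coord n → Matrix (Fin n) (Fin n) ℝ) : Prop :=
  ∀ a b, ContDiffOn ℝ ∞ (fun y => B y a b) U

variable {B C : Coord n → Matrix (Fin n) (Fin n) ℝ}

theorem MSmooth.diff (hB : MSmooth U B) (hU : IsOpen U) (hx : x ∈ U) (a b : Fin n) :
    DifferentiableAt ℝ (fun y => B y a b) x :=
  ContDiffOn.differentiableAt_of_isOpen hU (hB a b) hx

theorem MSmooth.mderiv (hB : MSmooth U B) (hU : IsOpen U) (i : Fin n) :
    MSmooth U (mderiv i B) := fun a b => contDiffOn_pderiv hU (hB a b) i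

theorem MSmooth.transpose (hB : MSmooth U B) : MSmooth U fun y => (B y).transpose :=
  fun a b => hB b a

theorem MSmooth.sub (hB : MSmooth U B) (hC : MSmooth U C) : MSmooth U fun y => B y - C y :=
  fun a b => (hB a b).sub (hC a b)

theorem MSmooth.mul (hB : MSmooth U B) (hC : MSmooth U C) : MSmooth U fun y => B y * C y :=
  fun a b => by
    simp only [Matrix.mul_apply]
    exact ContDiffOn.sum fun k _ => (hB a k).mul (hC k b)

theorem MSmooth.det (hB : MSmooth U B) : ContDiffOn ℝ ∞ (fun y => (B y).det) U := by
  simp only [Matrix.det_apply']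
  exact ContDiffOn.sum fun σ _ => contDiffOn_const.mul (contDiffOn_prod fun i _ => hB _ _)

theorem MSmooth.inv (hB : MSmooth U B) (hdet : ∀ y ∈ U, (B y).det ≠ 0) :
    MSmooth U fun y => (B y)⁻¹ := fun a b => by
  -- Cramer's rule: each entry of the inverse is a quotient of determinants, hence smooth.
  have : ∀ y, (B y)⁻¹ a b = ((B y).det)⁻¹ * ((B y).updateRow b (Pi.single a 1)).det := by
    intro y
    rw [Matrix.inv_def, Matrix.smul_apply, Matrix.adjugate_apply, smul_eq_mul,
      Ring.inverse_eq_inv']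
  simp only [this]
  refine (hB.det.inv hdet).mul (MSmooth.det fun i j => ?_)
  by_cases h : i = b
  · subst h; simpa using contDiffOn_const
  · simpa [Matrix.updateRow_ne h] using hB i j

theorem mderiv_sub (hB : MSmooth U B) (hC : MSmooth U C) (hU : IsOpen U) (hx : x ∈ U)
    (i : Fin n) : mderiv i (fun y => B y - C y) x = mderiv i B x - mderiv i C x := by
  ext a b
  exact pderiv_sub (hB.diff hU hx a b) (hC.diff hU hx a b) i

theorem mderiv_mul (hB : MSmooth U B) (hC : MSmooth U C) (hU : IsOpen U) (hx : x ∈ U)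
    (i : Fin n) :
    mderiv i (fun y => B y * C y) x = mderiv i B x * C x + B x * mderiv i C x := by
  ext a b
  simp only [mderiv, Matrix.mul_apply, Matrix.add_apply, Matrix.of_apply]
  rw [pderiv_sum _ fun k _ => (hB.diff hU hx a k).fun_mul (hC.diff hU hx k b),
    ← Finset.sum_add_distrib]
  exact Finset.sum_congr rfl fun k _ => pderiv_mul (hB.diff hU hx a k) (hC.diff hU hx k b) i

theorem mderiv_transpose (i : Fin n) :
    mderiv i (fun y => (B y).transpose) x = (mderiv i B x).transpose := rfl

theorem mderiv_comm (hB : MSmooth U B) (hU : IsOpen U) (hx : x ∈ U) (i j : Fin n) :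
    mderiv i (mderiv j B) x = mderiv j (mderiv i B) x := by
  ext a b
  exact pderiv_comm hU (hB a b) hx i j

end Calculus

/-! ### Levi-Civita connection, Ricci identity and symmetries of the Riemann tensor -/

section Connection

variable {n : ℕ} {U : Set (Coord n)} {G B : Coord n → Matrix (Fin n) (Fin n) ℝ} {x : Coord n}

/-- The connection matrices `(Γ_c)ᵏₐ`. -/
def connMatrix (G : Coord n → Matrix (Fin n) (Fin n) ℝ) (c : Fin n) (x : Coord n) :
    Matrix (Fin n) (Fin n) ℝ :=
  Matrix.of fun k a => christoffel G k c a x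

/-- The curvature endomorphism `R(∂ᵢ, ∂ⱼ)`. -/
def curvMatrix (G : Coord n → Matrix (Fin n) (Fin n) ℝ) (i j : Fin n) (x : Coord n) :
    Matrix (Fin n) (Fin n) ℝ :=
  Matrix.of fun k l => riemannUp G k l i j x

/-- The matrix `(∇_c B)_{ab}`. -/
def covMatrix (G B : Coord n → Matrix (Fin n) (Fin n) ℝ) (c : Fin n) (x : Coord n) :
    Matrix (Fin n) (Fin n) ℝ :=
  mderiv c B x - (connMatrix G c x).transpose * B x - B x * connMatrix G c x

theorem covMatrix_apply (c a b : Fin n) : covMatrix G B c x a b = covDeriv G B c a b x := by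
  simp only [covMatrix, covDeriv, mderiv, connMatrix, Matrix.sub_apply, Matrix.mul_apply,
    Matrix.transpose_apply, Matrix.of_apply]
  congr 1
  exact Finset.sum_congr rfl fun k _ => mul_comm _ _

theorem curvMatrix_eq (i j : Fin n) :
    curvMatrix G i j x = mderiv i (connMatrix G j) x - mderiv j (connMatrix G i) x
      + (connMatrix G i x * connMatrix G j x - connMatrix G j x * connMatrix G i x) := by
  ext k l
  simp [curvMatrix, riemannUp, mderiv, connMatrix, Matrix.mul_apply, Finset.sum_sub_distrib]

theorem contDiffOn_christoffel (hU : IsOpen U) (hG : MSmooth U G)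
    (hdet : ∀ y ∈ U, (G y).det ≠ 0) (k i j : Fin n) :
    ContDiffOn ℝ ∞ (christoffel G k i j) U :=
  contDiffOn_const.mul (ContDiffOn.sum fun l _ => (hG.inv hdet k l).mul
    (((contDiffOn_pderiv hU (hG l j) i).add (contDiffOn_pderiv hU (hG l i) j)).sub
      (contDiffOn_pderiv hU (hG i j) l)))

theorem msmooth_connMatrix (hU : IsOpen U) (hG : MSmooth U G)
    (hdet : ∀ y ∈ U, (G y).det ≠ 0) (c : Fin n) : MSmooth U (connMatrix G c) :=
  fun k a => contDiffOn_christoffel hU hG hdet k c a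

theorem msmooth_covMatrix (hU : IsOpen U) (hG : MSmooth U G)
    (hdet : ∀ y ∈ U, (G y).det ≠ 0) (hB : MSmooth U B) (c : Fin n) :
    MSmooth U (covMatrix G B c) :=
  have hΓ := msmooth_connMatrix hU hG hdet c
  ((hB.mderiv hU c).sub (hΓ.transpose.mul hB)).sub (hB.mul hΓ)

theorem contDiffOn_riemannUp (hU : IsOpen U) (hG : MSmooth U G)
    (hdet : ∀ y ∈ U, (G y).det ≠ 0) (k l i j : Fin n) :
    ContDiffOn ℝ ∞ (riemannUp G k l i j) U := by
  have h := contDiffOn_christoffel hU hG hdet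
  exact ((contDiffOn_pderiv hU (h k j l) i).sub (contDiffOn_pderiv hU (h k i l) j)).add
    (ContDiffOn.sum fun r _ => ((h k i r).mul (h r j l)).sub ((h k j r).mul (h r i l)))

theorem contDiffOn_weyl (hU : IsOpen U) (hG : MSmooth U G)
    (hdet : ∀ y ∈ U, (G y).det ≠ 0) (a b c d : Fin n) :
    ContDiffOn ℝ ∞ (fun y => weyl G y a b c d) U := by
  have hR := contDiffOn_riemannUp hU hG hdet
  have hric : ∀ b d, ContDiffOn ℝ ∞ (ricci G b d) U := fun b d =>
    ContDiffOn.sum fun k _ => hR k b k d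
  have hs : ContDiffOn ℝ ∞ (scalarCurv G) U :=
    ContDiffOn.sum fun b _ => ContDiffOn.sum fun d _ => (hG.inv hdet b d).mul (hric b d)
  have hRm : ContDiffOn ℝ ∞ (riemann G a b c d) U :=
    ContDiffOn.sum fun k _ => (hG a k).mul (hR k b c d)
  exact (hRm.sub (contDiffOn_const.mul (((((hG a c).mul (hric b d)).sub
    ((hG a d).mul (hric b c))).sub ((hG b c).mul (hric a d))).add
    ((hG b d).mul (hric a c))))).add ((hs.div_const _).mul
    (((hG a c).mul (hG b d)).sub ((hG a d).mul (hG b c))))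

/-- The Ricci identity for covariant `2`-tensors. -/
theorem ricci_identity (hU : IsOpen U) (hG : MSmooth U G) (hdet : ∀ y ∈ U, (G y).det ≠ 0)
    (hB : MSmooth U B) (hx : x ∈ U) (d c : Fin n) :
    (mderiv d (covMatrix G B c) x - (connMatrix G d x).transpose * covMatrix G B c x
        - covMatrix G B c x * connMatrix G d x)
      - (mderiv c (covMatrix G B d) x - (connMatrix G c x).transpose * covMatrix G B d x
        - covMatrix G B d x * connMatrix G c x)
      = -((curvMatrix G d c x).transpose * B x + B x * curvMatrix G d c x) := by
  -- No Christoffel correction is made for the derivative index: for a torsion-free connection it is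
  -- symmetric in `d`, `c` and would cancel.
  have hΓ := msmooth_connMatrix hU hG hdet
  have key : ∀ i j, mderiv i (covMatrix G B j) x = mderiv i (mderiv j B) x
      - ((mderiv i (connMatrix G j) x).transpose * B x
        + (connMatrix G j x).transpose * mderiv i B x)
      - (mderiv i B x * connMatrix G j x + B x * mderiv i (connMatrix G j) x) := by
    intro i j
    rw [← mderiv_transpose, ← mderiv_mul (hΓ j).transpose hB hU hx,
      ← mderiv_mul hB (hΓ j) hU hx,
      ← mderiv_sub (hB.mderiv hU j) ((hΓ j).transpose.mul hB) hU hx,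
      ← mderiv_sub ((hB.mderiv hU j).sub ((hΓ j).transpose.mul hB)) (hB.mul (hΓ j)) hU hx]
    rfl
  rw [key, key, curvMatrix_eq, mderiv_comm hB hU hx c d]
  simp only [covMatrix, Matrix.transpose_add, Matrix.transpose_sub, Matrix.transpose_mul]
  noncomm_ring

theorem lower_christoffel (hdet : (G x).det ≠ 0) (l i j : Fin n) :
    ∑ k, G x l k * christoffel G k i j x = (1 / 2) * (pderiv i (fun y => G y l j) x
      + pderiv j (fun y => G y l i) x - pderiv l (fun y => G y i j) x) := by
  have h1 : G x * (G x)⁻¹ = 1 := Matrix.mul_nonsing_inv _ (isUnit_iff_ne_zero.2 hdet)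
  have h2 : ∀ v : Fin n → ℝ, ∑ k, G x l k * ∑ r, (G x)⁻¹ k r * v r = v l := by
    intro v
    have h : (G x).mulVec ((G x)⁻¹.mulVec v) = v := by
      rw [Matrix.mulVec_mulVec, h1, Matrix.one_mulVec]
    exact congrFun h l
  rw [← h2 fun l => pderiv i (fun y => G y l j) x
      + pderiv j (fun y => G y l i) x - pderiv l (fun y => G y i j) x, Finset.mul_sum]
  exact Finset.sum_congr rfl fun k _ => by rw [christoffel]; ring

theorem christoffel_symm (hU : IsOpen U) (hx : x ∈ U) (hsym : ∀ y ∈ U, (G y).IsSymm)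
    (k i j : Fin n) : christoffel G k i j x = christoffel G k j i x := by
  have h : ∀ l, pderiv l (fun y => G y i j) x = pderiv l (fun y => G y j i) x := fun l =>
    pderiv_congr hU hx (fun y hy => (hsym y hy).apply j i) l
  simp only [christoffel, h]
  congr 1
  exact Finset.sum_congr rfl fun l _ => by ring

theorem covMatrix_metric (hU : IsOpen U) (hx : x ∈ U) (hsym : ∀ y ∈ U, (G y).IsSymm)
    (hdet : (G x).det ≠ 0) (c : Fin n) : covMatrix G G c x = 0 := by
  ext a b
  have h : ∀ l i j, pderiv l (fun y => G y i j) x = pderiv l (fun y => G y j i) x := fun l i j =>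
    pderiv_congr hU hx (fun y hy => (hsym y hy).apply j i) l
  rw [covMatrix_apply, covDeriv]
  have h1 : ∑ k, christoffel G k c a x * G x k b = ∑ k, G x b k * christoffel G k c a x :=
    Finset.sum_congr rfl fun k _ => by rw [(hsym x hx).apply b k, mul_comm]
  have h2 : ∑ k, christoffel G k c b x * G x a k = ∑ k, G x a k * christoffel G k c b x :=
    Finset.sum_congr rfl fun k _ => mul_comm _ _
  rw [h1, h2, lower_christoffel hdet, lower_christoffel hdet, h c b a, h a b c, h b a c]
  simp only [Matrix.zero_apply]
  ring

theorem riemann_eq (a b c d : Fin n) :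
    riemann G a b c d x = (G x * curvMatrix G c d x) a b := rfl

theorem riemann_antisymm_right (a b c d : Fin n) :
    riemann G a b c d x = -riemann G a b d c x := by
  have : curvMatrix G c d x = -curvMatrix G d c x := by
    rw [curvMatrix_eq, curvMatrix_eq]; abel
  rw [riemann_eq, riemann_eq, this, Matrix.mul_neg, Matrix.neg_apply]

/-- The Ricci identity is applied to the metric itself, for which ∇g = 0. -/
theorem riemann_antisymm_left (hU : IsOpen U) (hG : MSmooth U G)
    (hdet : ∀ y ∈ U, (G y).det ≠ 0) (hsym : ∀ y ∈ U, (G y).IsSymm) (hx : x ∈ U)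
    (a b c d : Fin n) : riemann G a b c d x = -riemann G b a c d x := by
  have h := ricci_identity hU hG hdet hG hx c d
  have h0 : ∀ i j, mderiv i (covMatrix G G j) x = 0 := fun i j => by
    ext a b
    have := pderiv_congr hU hx (f := fun y => covMatrix G G j y a b) (h := fun _ => 0)
      (fun y hy => by rw [covMatrix_metric hU hy hsym (hdet y hy)]; rfl) i
    rw [pderiv_const] at this
    exact this
  rw [h0, h0, covMatrix_metric hU hx hsym (hdet x hx),
    covMatrix_metric hU hx hsym (hdet x hx)] at h
  have h2 := congrFun (congrFun h a) b
  have h3 : ((curvMatrix G c d x).transpose * G x) a b = (G x * curvMatrix G c d x) b a := by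
    rw [← Matrix.transpose_apply (G x * curvMatrix G c d x), Matrix.transpose_mul, hsym x hx]
  simp only [Matrix.mul_zero, Matrix.zero_mul, sub_zero, Matrix.zero_apply, Matrix.neg_apply,
    Matrix.add_apply, h3] at h2
  rw [riemann_eq, riemann_eq]
  linarith

/-- By the symmetry Γᵏᵢⱼ = Γᵏⱼᵢ, both the derivative terms and the quadratic terms cancel in the
cyclic sum. -/
theorem riemann_bianchi (hU : IsOpen U) (hsym : ∀ y ∈ U, (G y).IsSymm) (hx : x ∈ U)
    (a b c d : Fin n) :
    riemann G a b c d x + riemann G a c d b x + riemann G a d b c x = 0 := by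
  have hs : ∀ k i j, ∀ y ∈ U, christoffel G k i j y = christoffel G k j i y :=
    fun k i j y hy => christoffel_symm hU hy hsym k i j
  have hp : ∀ l k i j, pderiv l (christoffel G k i j) x = pderiv l (christoffel G k j i) x :=
    fun l k i j => pderiv_congr hU hx (hs k i j) l
  simp only [riemann, ← Finset.sum_add_distrib, ← mul_add]
  refine Finset.sum_eq_zero fun k _ => mul_eq_zero_of_right _ ?_
  simp only [riemannUp]
  rw [hp b k c d, hp c k d b, hp d k b c]
  have : ∑ r, (christoffel G k c r x * christoffel G r d b x
        - christoffel G k d r x * christoffel G r c b x)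
      + ∑ r, (christoffel G k d r x * christoffel G r b c x
        - christoffel G k b r x * christoffel G r d c x)
      + ∑ r, (christoffel G k b r x * christoffel G r c d x
        - christoffel G k c r x * christoffel G r b d x) = 0 := by
    simp only [← Finset.sum_add_distrib]
    refine Finset.sum_eq_zero fun r _ => ?_
    rw [hs r b c x hx, hs r c d x hx, hs r d b x hx]
    ring
  linarith

end Connection

/-! ### Derivation action and Kulkarni-Nomizu product -/

section CurvatureAlgebra

variable {n : ℕ}

/-- The pair symmetry follows from the antisymmetries and the first Bianchi identity. -/
theorem pair_symm_of_bianchi {ι : Type*} {R : ι → ι → ι → ι → ℝ}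
    (h1 : ∀ a b c d, R a b c d = -R b a c d) (h2 : ∀ a b c d, R a b c d = -R a b d c)
    (h3 : ∀ a b c d, R a b c d + R a c d b + R a d b c = 0) (a b c d : ι) :
    R a b c d = R c d a b := by
  linarith [h3 a b c d, h3 b c d a, h3 c d a b, h3 d a b c, h1 a b c d, h1 c d a b,
    h1 b c d a, h1 b d a c, h1 b a c d, h1 c a b d, h1 c b d a, h1 d a b c, h1 d b c a,
    h1 d c a b, h2 a b c d, h2 a c d b, h2 a d b c, h2 b c d a, h2 b d a c, h2 c d a b,
    h2 c a b d, h2 c b d a, h2 d a b c, h2 d b c a, h2 d c a b, h2 b a c d]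

/-- The derivation action of an endomorphism `A` on covariant `4`-tensors. -/
def tensorAct (A : Matrix (Fin n) (Fin n) ℝ) (R : Fin n → Fin n → Fin n → Fin n → ℝ)
    (a b c d : Fin n) : ℝ :=
  ∑ e, (A e a * R e b c d + A e b * R a e c d + A e c * R a b e d + A e d * R a b c e)

/-- The Kulkarni-Nomizu product. -/
def kulkarniNomizu (G P : Matrix (Fin n) (Fin n) ℝ) (a b c d : Fin n) : ℝ :=
  G a c * P b d - G a d * P b c - G b c * P a d + G b d * P a c

end CurvatureAlgebra

/-! ### Integrability condition of the conformal Killing-Yano equation -/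

section Integrability

variable {n : ℕ} {U : Set (Coord n)} {G Φ : Coord n → Matrix (Fin n) (Fin n) ℝ} {x : Coord n}

/-- A metric and a conformal Killing-Yano `2`-form, given by components on an open set. -/
structure LocalCKY (U : Set (Coord n)) (G Φ : Coord n → Matrix (Fin n) (Fin n) ℝ) : Prop where
  dim : 4 ≤ n
  isOpen : IsOpen U
  smoothG : MSmooth U G
  smoothΦ : MSmooth U Φ
  symm : ∀ y ∈ U, (G y).IsSymm
  det : ∀ y ∈ U, (G y).det ≠ 0
  alt : ∀ y ∈ U, (Φ y).transpose = -Φ y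
  cky : ∀ y ∈ U, CKYEquationAt G Φ y

/-- The divergence `1`-form `K_b = gᶜᵃ ∇_c φ_{ab}`. -/
def divForm (G Φ : Coord n → Matrix (Fin n) (Fin n) ℝ) (b : Fin n) (y : Coord n) : ℝ :=
  ∑ c, ∑ a, (G y)⁻¹ c a * covMatrix G Φ c y a b

/-- The `3`-form part of `∇φ`. -/
def threeForm (G Φ : Coord n → Matrix (Fin n) (Fin n) ℝ) (c a b : Fin n) (y : Coord n) : ℝ :=
  covMatrix G Φ c y a b
    - 1 / ((n : ℝ) - 1) * (G y c a * divForm G Φ b y - G y c b * divForm G Φ a y)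

theorem contDiffOn_divForm (h : LocalCKY U G Φ) (b : Fin n) :
    ContDiffOn ℝ ∞ (divForm G Φ b) U :=
  ContDiffOn.sum fun c _ => ContDiffOn.sum fun a _ => (h.smoothG.inv h.det c a).mul
    (msmooth_covMatrix h.isOpen h.smoothG h.det h.smoothΦ c a b)

theorem contDiffOn_threeForm (h : LocalCKY U G Φ) (c a b : Fin n) :
    ContDiffOn ℝ ∞ (threeForm G Φ c a b) U :=
  (msmooth_covMatrix h.isOpen h.smoothG h.det h.smoothΦ c a b).sub
    (contDiffOn_const.mul (((h.smoothG c a).mul (contDiffOn_divForm h b)).sub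
      ((h.smoothG c b).mul (contDiffOn_divForm h a))))

theorem sum_antisymm {ι : Type*} [Fintype ι] {F : ι → ι → ℝ} (hF : ∀ a b, F a b = -F b a) :
    ∑ a, ∑ b, F a b = 0 := by
  have h : ∑ a, ∑ b, F a b = -∑ a, ∑ b, F a b := by
    conv_lhs => rw [Finset.sum_comm]
    simp only [← Finset.sum_neg_distrib]
    exact Finset.sum_congr rfl fun b _ => Finset.sum_congr rfl fun a _ => hF a b
  linarith

theorem inv_symm_apply {S : Matrix (Fin n) (Fin n) ℝ} (hS : S.IsSymm) (a b : Fin n) :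
    S⁻¹ a b = S⁻¹ b a := by
  rw [← Matrix.transpose_apply S⁻¹ a b, Matrix.transpose_nonsing_inv, hS]

theorem sum_inv_mul {S : Matrix (Fin n) (Fin n) ℝ} (hdet : S.det ≠ 0) (a b : Fin n) :
    ∑ c, S⁻¹ a c * S c b = if a = b then 1 else 0 := by
  rw [← Matrix.mul_apply, Matrix.nonsing_inv_mul _ (isUnit_iff_ne_zero.2 hdet), Matrix.one_apply]

/-- The equation supplies τ and K only pointwise, with no regularity. Identifying them with the
explicit expressions `threeForm` and `divForm`, which are smooth, is what allows them to be
differentiated. -/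
theorem threeForm_antisymm (h : LocalCKY U G Φ) {y : Coord n} (hy : y ∈ U) (c a b : Fin n) :
    threeForm G Φ c a b y = -threeForm G Φ a c b y ∧
      threeForm G Φ c a b y = -threeForm G Φ c b a y := by
  obtain ⟨τ, K, h1, h2, h3⟩ := h.cky y hy
  have hn : (n : ℝ) - 1 ≠ 0 := by
    have : (4 : ℝ) ≤ n := by exact_mod_cast h.dim
    linarith
  -- Tracing the equation with gᶜᵃ removes τ and leaves (n K_b - K_b) / (n - 1) = K_b.
  have hK : ∀ b, divForm G Φ b y = K b := by
    intro b
    have e1 : ∑ c, ∑ a, (G y)⁻¹ c a * τ c a b = 0 := sum_antisymm fun c a => by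
      rw [inv_symm_apply (h.symm y hy) c a, h1 c a b]; ring
    have e2 : ∑ c, ∑ a, (G y)⁻¹ c a * (G y c a * K b) = n * K b := by
      simp only [← mul_assoc, ← Finset.sum_mul]
      congr 1
      have : ∀ c, ∑ a, (G y)⁻¹ c a * G y c a = 1 := by
        intro c
        rw [← (if_pos rfl : (if c = c then (1 : ℝ) else 0) = 1), ← sum_inv_mul (h.det y hy) c c]
        exact Finset.sum_congr rfl fun a _ => by rw [(h.symm y hy).apply a c]
      simp [this]
    have e3 : ∑ c, ∑ a, (G y)⁻¹ c a * (G y c b * K a) = K b := by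
      rw [Finset.sum_comm]
      have : ∀ a, ∑ c, (G y)⁻¹ c a * (G y c b * K a) = (if a = b then 1 else 0) * K a := by
        intro a
        rw [← sum_inv_mul (h.det y hy) a b, Finset.sum_mul]
        exact Finset.sum_congr rfl fun c _ => by rw [inv_symm_apply (h.symm y hy) c a]; ring
      simp [this]
    have e4 : divForm G Φ b y = ∑ c, ∑ a, (G y)⁻¹ c a * τ c a b + 1 / ((n : ℝ) - 1) *
        (∑ c, ∑ a, (G y)⁻¹ c a * (G y c a * K b) - ∑ c, ∑ a, (G y)⁻¹ c a * (G y c b * K a)) := by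
      simp only [divForm, Finset.mul_sum, ← Finset.sum_sub_distrib, ← Finset.sum_add_distrib,
        covMatrix_apply, h3]
      exact Finset.sum_congr rfl fun c _ => Finset.sum_congr rfl fun a _ => by ring
    rw [e4, e1, e2, e3]
    field_simp
    ring
  have hτ : ∀ c a b, threeForm G Φ c a b y = τ c a b := fun c a b => by
    rw [threeForm, covMatrix_apply, h3, hK, hK]; ring
  simp only [hτ]
  exact ⟨h1 c a b, h2 c a b⟩

/-- The covariant derivative of the divergence `1`-form. -/
def covDivForm (G Φ : Coord n → Matrix (Fin n) (Fin n) ℝ) (d b : Fin n) (x : Coord n) : ℝ :=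
  pderiv d (divForm G Φ b) x - ∑ k, christoffel G k d b x * divForm G Φ k x

/-- The covariant derivative of the `3`-form part of `∇φ`. -/
def covThreeForm (G Φ : Coord n → Matrix (Fin n) (Fin n) ℝ) (d c a b : Fin n) (x : Coord n) :
    ℝ :=
  pderiv d (threeForm G Φ c a b) x - ∑ k, (christoffel G k d c x * threeForm G Φ k a b x
    + christoffel G k d a x * threeForm G Φ c k b x
    + christoffel G k d b x * threeForm G Φ c a k x)

theorem covThreeForm_antisymm (h : LocalCKY U G Φ) (hx : x ∈ U) (d c a b : Fin n) :
    covThreeForm G Φ d c a b x = -covThreeForm G Φ d a c b x ∧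
      covThreeForm G Φ d c a b x = -covThreeForm G Φ d c b a x := by
  have h1 := fun c a b => (threeForm_antisymm h hx c a b).1
  have h2 := fun c a b => (threeForm_antisymm h hx c a b).2
  have p1 : pderiv d (threeForm G Φ c a b) x = -pderiv d (threeForm G Φ a c b) x := by
    rw [← pderiv_neg]
    exact pderiv_congr h.isOpen hx (fun y hy => (threeForm_antisymm h hy c a b).1) d
  have p2 : pderiv d (threeForm G Φ c a b) x = -pderiv d (threeForm G Φ c b a) x := by
    rw [← pderiv_neg]
    exact pderiv_congr h.isOpen hx (fun y hy => (threeForm_antisymm h hy c a b).2) d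
  constructor
  · have : ∑ k, (christoffel G k d c x * threeForm G Φ k a b x
        + christoffel G k d a x * threeForm G Φ c k b x
        + christoffel G k d b x * threeForm G Φ c a k x)
      = -∑ k, (christoffel G k d a x * threeForm G Φ k c b x
        + christoffel G k d c x * threeForm G Φ a k b x
        + christoffel G k d b x * threeForm G Φ a c k x) := by
      rw [← Finset.sum_neg_distrib]
      exact Finset.sum_congr rfl fun k _ => by rw [h1 k a b, h1 c k b, h1 c a k]; ring
    rw [covThreeForm, covThreeForm, p1, this]
    ring
  · have : ∑ k, (christoffel G k d c x * threeForm G Φ k a b x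
        + christoffel G k d a x * threeForm G Φ c k b x
        + christoffel G k d b x * threeForm G Φ c a k x)
      = -∑ k, (christoffel G k d c x * threeForm G Φ k b a x
        + christoffel G k d b x * threeForm G Φ c k a x
        + christoffel G k d a x * threeForm G Φ c b k x) := by
      rw [← Finset.sum_neg_distrib]
      exact Finset.sum_congr rfl fun k _ => by rw [h2 k a b, h2 c k b, h2 c a k]; ring
    rw [covThreeForm, covThreeForm, p2, this]
    ring

theorem pderiv_metric (h : LocalCKY U G Φ) (hx : x ∈ U) (d c a : Fin n) :
    pderiv d (fun y => G y c a) x = ∑ k, christoffel G k d c x * G x k a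
      + ∑ k, christoffel G k d a x * G x c k := by
  have := congrFun (congrFun (covMatrix_metric h.isOpen hx h.symm (h.det x hx) d) c) a
  rw [covMatrix_apply, covDeriv, Matrix.zero_apply] at this
  linarith

/-- The product rule with ∇g = 0. The left side lacks the correction for the index `c`, so the term
Γᵏ_{dc} ∇_kφ_{ab} remains; it is symmetric in `d`, `c` and disappears in `curvature_act`. -/
theorem deriv_covMatrix (h : LocalCKY U G Φ) (hx : x ∈ U) (d c a b : Fin n) :
    (mderiv d (covMatrix G Φ c) x - (connMatrix G d x).transpose * covMatrix G Φ c x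
        - covMatrix G Φ c x * connMatrix G d x) a b
      = covThreeForm G Φ d c a b x + ∑ k, christoffel G k d c x * covMatrix G Φ k x a b
        + 1 / ((n : ℝ) - 1)
          * (G x c a * covDivForm G Φ d b x - G x c b * covDivForm G Φ d a x) := by
  set κ : ℝ := 1 / ((n : ℝ) - 1) with hκ
  have hC : ∀ c a b y, covMatrix G Φ c y a b = threeForm G Φ c a b y
      + κ * (G y c a * divForm G Φ b y - G y c b * divForm G Φ a y) := fun c a b y => by
    rw [threeForm]; ring
  have dG := fun i j => h.smoothG.diff h.isOpen hx i j
  have dK := fun i => ContDiffOn.differentiableAt_of_isOpen h.isOpen (contDiffOn_divForm h i) hx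
  have dτ := ContDiffOn.differentiableAt_of_isOpen h.isOpen (contDiffOn_threeForm h c a b) hx
  have e0 : pderiv d (fun y => covMatrix G Φ c y a b) x = pderiv d (threeForm G Φ c a b) x
      + κ * ((pderiv d (fun y => G y c a) x * divForm G Φ b x
          + G x c a * pderiv d (divForm G Φ b) x)
        - (pderiv d (fun y => G y c b) x * divForm G Φ a x
          + G x c b * pderiv d (divForm G Φ a) x)) := by
    simp only [hC]
    rw [pderiv_add dτ ((((dG c a).fun_mul (dK b)).fun_sub ((dG c b).fun_mul (dK a))).const_mul κ),
      pderiv_const_mul (((dG c a).fun_mul (dK b)).fun_sub ((dG c b).fun_mul (dK a))),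
      pderiv_sub ((dG c a).fun_mul (dK b)) ((dG c b).fun_mul (dK a)),
      pderiv_mul (dG c a) (dK b), pderiv_mul (dG c b) (dK a)]
  have e1 : ((connMatrix G d x).transpose * covMatrix G Φ c x) a b
      = ∑ k, christoffel G k d a x * threeForm G Φ c k b x
        + κ * ((∑ k, christoffel G k d a x * G x c k) * divForm G Φ b x
          - G x c b * ∑ k, christoffel G k d a x * divForm G Φ k x) := by
    simp only [Matrix.mul_apply, Matrix.transpose_apply, connMatrix, Matrix.of_apply, hC,
      Finset.mul_sum, Finset.sum_mul, ← Finset.sum_add_distrib, ← Finset.sum_sub_distrib]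
    exact Finset.sum_congr rfl fun k _ => by ring
  have e2 : (covMatrix G Φ c x * connMatrix G d x) a b
      = ∑ k, christoffel G k d b x * threeForm G Φ c a k x
        + κ * (G x c a * (∑ k, christoffel G k d b x * divForm G Φ k x)
          - (∑ k, christoffel G k d b x * G x c k) * divForm G Φ a x) := by
    simp only [Matrix.mul_apply, connMatrix, Matrix.of_apply, hC,
      Finset.mul_sum, Finset.sum_mul, ← Finset.sum_add_distrib, ← Finset.sum_sub_distrib]
    exact Finset.sum_congr rfl fun k _ => by ring
  have e3 : ∑ k, christoffel G k d c x * covMatrix G Φ k x a b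
      = ∑ k, christoffel G k d c x * threeForm G Φ k a b x
        + κ * ((∑ k, christoffel G k d c x * G x k a) * divForm G Φ b x
          - (∑ k, christoffel G k d c x * G x k b) * divForm G Φ a x) := by
    simp only [hC, Finset.mul_sum, Finset.sum_mul, ← Finset.sum_add_distrib,
      ← Finset.sum_sub_distrib]
    exact Finset.sum_congr rfl fun k _ => by ring
  rw [Matrix.sub_apply, Matrix.sub_apply, e1, e2, e3, mderiv, Matrix.of_apply, e0,
    pderiv_metric h hx, pderiv_metric h hx, covThreeForm, covDivForm, covDivForm,
    Finset.sum_add_distrib, Finset.sum_add_distrib]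
  ring

/-- The curvature, acting on `φ`, in terms of the derivatives of the `3`-form and `1`-form parts
of `∇φ`. -/
theorem curvature_act (h : LocalCKY U G Φ) (hx : x ∈ U) (d c a b : Fin n) :
    -((curvMatrix G d c x).transpose * Φ x + Φ x * curvMatrix G d c x) a b
      = covThreeForm G Φ d c a b x - covThreeForm G Φ c d a b x
        + 1 / ((n : ℝ) - 1)
          * (G x c a * covDivForm G Φ d b x - G x c b * covDivForm G Φ d a x
            - G x d a * covDivForm G Φ c b x + G x d b * covDivForm G Φ c a x) := by
  have e := congrFun (congrFun
    (ricci_identity h.isOpen h.smoothG h.det h.smoothΦ hx d c) a) b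
  rw [Matrix.sub_apply, deriv_covMatrix h hx, deriv_covMatrix h hx, Matrix.neg_apply] at e
  rw [← e]
  simp only [christoffel_symm h.isOpen hx h.symm _ c d]
  ring

theorem riemann_pair_symm (h : LocalCKY U G Φ) (hx : x ∈ U) (a b c d : Fin n) :
    riemann G a b c d x = riemann G c d a b x :=
  pair_symm_of_bianchi (R := fun a b c d => riemann G a b c d x)
    (riemann_antisymm_left h.isOpen h.smoothG h.det h.symm hx) riemann_antisymm_right
    (riemann_bianchi h.isOpen h.symm hx) a b c d

/-- Moving the metric past the curvature turns R acting on φ into A = g⁻¹φ acting on the second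
index pair of R, which is half of `tensorAct`. -/
theorem curvature_act_eq_sum (h : LocalCKY U G Φ) (hx : x ∈ U) (d c a b : Fin n) :
    -((curvMatrix G d c x).transpose * Φ x + Φ x * curvMatrix G d c x) a b
      = ∑ e, (((G x)⁻¹ * Φ x) e a * riemann G d c e b x
        + ((G x)⁻¹ * Φ x) e b * riemann G d c a e x) := by
  set A := (G x)⁻¹ * Φ x
  have hΦ : Φ x = G x * A := by
    rw [Matrix.mul_nonsing_inv_cancel_left _ _ (isUnit_iff_ne_zero.2 (h.det x hx))]
  have e1 : ((curvMatrix G d c x).transpose * Φ x) a b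
      = ∑ e, A e b * riemann G e a d c x := by
    rw [hΦ, ← Matrix.mul_assoc]
    have : (curvMatrix G d c x).transpose * G x = (G x * curvMatrix G d c x).transpose := by
      rw [Matrix.transpose_mul, h.symm x hx]
    rw [this, Matrix.mul_apply]
    exact Finset.sum_congr rfl fun e _ => by
      rw [Matrix.transpose_apply, riemann_eq, mul_comm]
  have e2 : (Φ x * curvMatrix G d c x) a b = -∑ e, A e a * riemann G e b d c x := by
    have : Φ x = -(A.transpose * G x) := by
      rw [← neg_eq_iff_eq_neg, ← h.alt x hx, hΦ, Matrix.transpose_mul, h.symm x hx]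
    rw [this, Matrix.neg_mul, Matrix.mul_assoc, Matrix.neg_apply, Matrix.mul_apply]
    rfl
  rw [Matrix.add_apply, e1, e2, ← sub_eq_add_neg, neg_sub, ← Finset.sum_sub_distrib]
  refine Finset.sum_congr rfl fun e _ => ?_
  rw [riemann_pair_symm h hx d c e b, riemann_pair_symm h hx d c a e,
    riemann_antisymm_left h.isOpen h.smoothG h.det h.symm hx a e d c]
  ring

/-- The integrability condition of the conformal Killing-Yano equation, before the removal of
traces. -/
theorem tensorAct_riemann (h : LocalCKY U G Φ) (hx : x ∈ U) :
    ∃ (Ω : Fin n → Fin n → Fin n → Fin n → ℝ) (N : Matrix (Fin n) (Fin n) ℝ),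
      (∀ a b c d, Ω a c d b = Ω a b c d) ∧ N.IsSymm ∧
      ∀ a b c d, tensorAct ((G x)⁻¹ * Φ x) (fun a b c d => riemann G a b c d x) a b c d
        = Ω a b c d + kulkarniNomizu (G x) N a b c d := by
  have t1 := fun d c a b => (covThreeForm_antisymm h hx d c a b).1
  have t2 := fun d c a b => (covThreeForm_antisymm h hx d c a b).2
  -- Since ∇τ is alternating in its last three indices, the first witness is the exterior derivative
  -- dτ; only its cyclic symmetry is needed. The symmetric N comes from adding the ∇K terms of the
  -- two index pairs.
  refine ⟨fun d c a b => covThreeForm G Φ d c a b x - covThreeForm G Φ c d a b x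
      + covThreeForm G Φ a b d c x - covThreeForm G Φ b a d c x,
    Matrix.of fun a b => -(1 / ((n : ℝ) - 1)
      * (covDivForm G Φ a b x + covDivForm G Φ b a x)), ?_, ?_, ?_⟩
  · intro d c a b
    linarith [t1 d c a b, t2 d a c b, t1 d a b c, t2 d a b c, t1 a d b c, t2 a d b c, t1 c d a b,
      t2 c d a b, t1 a b d c, t2 a b d c, t1 b a d c, t2 b a d c, t1 c a d b, t1 c d b a,
      t2 c b d a, t1 c b d a, t1 a d c b, t2 a d c b, t1 b d c a, t2 b d c a, t1 a c d b,
      t2 a c d b, t2 c a d b, t1 b d a c, t2 b d a c, t1 b c d a, t2 b c d a]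
  · ext a b
    simp only [Matrix.transpose_apply, Matrix.of_apply]
    ring
  · intro d c a b
    have e1 := curvature_act h hx d c a b
    have e2 := curvature_act h hx a b d c
    rw [curvature_act_eq_sum h hx] at e1 e2
    -- Pair symmetry of R makes the action on the first pair another instance of the action on the
    -- second pair, with the pairs exchanged.
    have e3 : tensorAct ((G x)⁻¹ * Φ x) (fun a b c d => riemann G a b c d x) d c a b
        = ∑ e, (((G x)⁻¹ * Φ x) e a * riemann G d c e b x
          + ((G x)⁻¹ * Φ x) e b * riemann G d c a e x)
        + ∑ e, (((G x)⁻¹ * Φ x) e d * riemann G a b e c x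
          + ((G x)⁻¹ * Φ x) e c * riemann G a b d e x) := by
      rw [tensorAct, ← Finset.sum_add_distrib]
      refine Finset.sum_congr rfl fun e _ => ?_
      rw [riemann_pair_symm h hx a b e c, riemann_pair_symm h hx a b d e]
      ring
    have g := (h.symm x hx).apply
    simp only [kulkarniNomizu, Matrix.of_apply]
    rw [e3, e1, e2, g a c, g b c, g a d, g b d]
    ring

end Integrability

/-! ### The Weyl tensor is annihilated by φ -/

section WeylInvariance

variable {n : ℕ} {U : Set (Coord n)} {G Φ : Coord n → Matrix (Fin n) (Fin n) ℝ} {x : Coord n}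

theorem tensorAct_sub (A : Matrix (Fin n) (Fin n) ℝ) (R S : Fin n → Fin n → Fin n → Fin n → ℝ)
    (a b c d : Fin n) :
    tensorAct A (fun a b c d => R a b c d - S a b c d) a b c d
      = tensorAct A R a b c d - tensorAct A S a b c d := by
  simp only [tensorAct, ← Finset.sum_sub_distrib]
  exact Finset.sum_congr rfl fun e _ => by ring

theorem tensorAct_bianchi {A : Matrix (Fin n) (Fin n) ℝ}
    {R : Fin n → Fin n → Fin n → Fin n → ℝ}
    (hR : ∀ a b c d, R a b c d + R a c d b + R a d b c = 0) (a b c d : Fin n) :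
    tensorAct A R a b c d + tensorAct A R a c d b + tensorAct A R a d b c = 0 := by
  simp only [tensorAct, ← Finset.sum_add_distrib]
  refine Finset.sum_eq_zero fun e _ => ?_
  linear_combination A e a * hR e b c d + A e b * hR a e c d + A e c * hR a b e d
    + A e d * hR a b c e

theorem kulkarniNomizu_bianchi {S P : Matrix (Fin n) (Fin n) ℝ} (hS : S.IsSymm) (hP : P.IsSymm)
    (a b c d : Fin n) :
    kulkarniNomizu S P a b c d + kulkarniNomizu S P a c d b + kulkarniNomizu S P a d b c = 0 := by
  simp only [kulkarniNomizu]
  rw [hS.apply b c, hP.apply b c, hS.apply b d, hP.apply b d, hS.apply c d, hP.apply c d]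
  ring

/-- `F` is antisymmetric, so `A` is infinitesimally orthogonal: the derivation kills `S` and acts
only on `P`, as Aᵀ P + P A. -/
theorem tensorAct_kulkarniNomizu {S F A P : Matrix (Fin n) (Fin n) ℝ} (hS : S.IsSymm)
    (hP : P.IsSymm) (hF : F.transpose = -F) (hA : S * A = F) (a b c d : Fin n) :
    tensorAct A (kulkarniNomizu S P) a b c d
      = kulkarniNomizu S (A.transpose * P + P * A) a b c d := by
  have f : ∀ i j, ∑ e, A e i * S j e = F j i := fun i j => by
    rw [← hA, Matrix.mul_apply]
    exact Finset.sum_congr rfl fun e _ => mul_comm _ _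
  have f' : ∀ i j, ∑ e, A e i * S e j = F j i := fun i j => by
    rw [← f]
    exact Finset.sum_congr rfl fun e _ => by rw [hS.apply j e]
  have ha : ∀ i j, F i j = -F j i := fun i j => by
    rw [← Matrix.transpose_apply F j i, hF, Matrix.neg_apply]
  have q : ∀ i j, (A.transpose * P + P * A) i j = ∑ e, A e i * P e j + ∑ e, A e j * P i e :=
    fun i j => by
      simp only [Matrix.add_apply, Matrix.mul_apply, Matrix.transpose_apply]
      congr 1
      exact Finset.sum_congr rfl fun e _ => mul_comm _ _
  have q' : ∀ i j, ∑ e, A e j * P i e = ∑ e, A e j * P e i := fun i j =>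
    Finset.sum_congr rfl fun e _ => by rw [hP.apply e i]
  have : tensorAct A (kulkarniNomizu S P) a b c d
      = ((∑ e, A e a * S e c) * P b d - (∑ e, A e a * S e d) * P b c
          - S b c * (∑ e, A e a * P e d) + S b d * (∑ e, A e a * P e c))
        + (S a c * (∑ e, A e b * P e d) - S a d * (∑ e, A e b * P e c)
          - (∑ e, A e b * S e c) * P a d + (∑ e, A e b * S e d) * P a c)
        + ((∑ e, A e c * S a e) * P b d - S a d * (∑ e, A e c * P b e)
          - (∑ e, A e c * S b e) * P a d + S b d * (∑ e, A e c * P a e))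
        + (S a c * (∑ e, A e d * P b e) - (∑ e, A e d * S a e) * P b c
          - S b c * (∑ e, A e d * P a e) + (∑ e, A e d * S b e) * P a c) := by
    simp only [tensorAct, kulkarniNomizu, Finset.mul_sum, Finset.sum_mul,
      ← Finset.sum_sub_distrib, ← Finset.sum_add_distrib]
    exact Finset.sum_congr rfl fun e _ => by ring
  rw [this]
  simp only [kulkarniNomizu, q, q', f, f']
  rw [ha c a, ha d a, ha c b, ha d b]
  ring

theorem sum_inv_mul_self {S : Matrix (Fin n) (Fin n) ℝ} (hS : S.IsSymm) (hdet : S.det ≠ 0) :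
    ∑ a, ∑ c, S⁻¹ a c * S a c = n := by
  have : ∀ a, ∑ c, S⁻¹ a c * S a c = 1 := fun a => by
    rw [← (if_pos rfl : (if a = a then (1 : ℝ) else 0) = 1), ← sum_inv_mul hdet a a]
    exact Finset.sum_congr rfl fun c _ => by rw [hS.apply c a]
  simp [this]

theorem trace_kulkarniNomizu {S P : Matrix (Fin n) (Fin n) ℝ} (hS : S.IsSymm)
    (hdet : S.det ≠ 0) (b d : Fin n) :
    ∑ a, ∑ c, S⁻¹ a c * kulkarniNomizu S P a b c d
      = (n - 2) * P b d + (∑ a, ∑ c, S⁻¹ a c * P a c) * S b d := by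
  have e1 : ∑ a, ∑ c, S⁻¹ a c * (S a d * P b c) = P b d := by
    rw [Finset.sum_comm]
    have : ∀ c, ∑ a, S⁻¹ a c * (S a d * P b c) = (if c = d then 1 else 0) * P b c := fun c => by
      rw [← sum_inv_mul hdet c d, Finset.sum_mul]
      exact Finset.sum_congr rfl fun a _ => by rw [inv_symm_apply hS a c]; ring
    simp [this]
  have e2 : ∑ a, ∑ c, S⁻¹ a c * (S b c * P a d) = P b d := by
    have : ∀ a, ∑ c, S⁻¹ a c * (S b c * P a d) = (if a = b then 1 else 0) * P a d := fun a => by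
      rw [← sum_inv_mul hdet a b, Finset.sum_mul]
      exact Finset.sum_congr rfl fun c _ => by rw [hS.apply c b]; ring
    simp [this]
  have e3 : ∑ a, ∑ c, S⁻¹ a c * kulkarniNomizu S P a b c d
      = (∑ a, ∑ c, S⁻¹ a c * S a c) * P b d - ∑ a, ∑ c, S⁻¹ a c * (S a d * P b c)
        - ∑ a, ∑ c, S⁻¹ a c * (S b c * P a d) + (∑ a, ∑ c, S⁻¹ a c * P a c) * S b d := by
    simp only [kulkarniNomizu, Finset.sum_mul, ← Finset.sum_sub_distrib,
      ← Finset.sum_add_distrib]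
    exact Finset.sum_congr rfl fun a _ => Finset.sum_congr rfl fun c _ => by ring
  rw [e3, e1, e2, sum_inv_mul_self hS hdet]
  ring

/-- Acting on the two traced indices gives cancelling terms, because A S⁻¹ is antisymmetric; acting
on the other two gives combinations of traces of `R`. -/
theorem trace_tensorAct {S F : Matrix (Fin n) (Fin n) ℝ} (hS : S.IsSymm)
    (hF : F.transpose = -F) {R : Fin n → Fin n → Fin n → Fin n → ℝ}
    (hR : ∀ b d, ∑ a, ∑ c, S⁻¹ a c * R a b c d = 0) (b d : Fin n) :
    ∑ a, ∑ c, S⁻¹ a c * tensorAct (S⁻¹ * F) R a b c d = 0 := by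
  set A := S⁻¹ * F with hA
  set T := A * S⁻¹ with hT
  have hTa : ∀ i j, T i j = -T j i := fun i j => by
    have : T.transpose = -T := by
      rw [hT, hA, Matrix.transpose_mul, Matrix.transpose_mul, Matrix.transpose_nonsing_inv, hS, hF]
      noncomm_ring
    rw [← Matrix.transpose_apply T j i, this, Matrix.neg_apply]
  have e1 : ∑ a, ∑ c, ∑ e, S⁻¹ a c * (A e a * R e b c d) = ∑ e, ∑ c, T e c * R e b c d := by
    simp only [hT, Matrix.mul_apply, Finset.sum_mul]
    rw [Finset.sum_comm]
    conv_rhs => rw [Finset.sum_comm]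
    refine Finset.sum_congr rfl fun c _ => ?_
    rw [Finset.sum_comm]
    exact Finset.sum_congr rfl fun e _ => Finset.sum_congr rfl fun a _ => by ring
  have e2 : ∑ a, ∑ c, ∑ e, S⁻¹ a c * (A e c * R a b e d) = -∑ e, ∑ c, T e c * R e b c d := by
    simp only [← Finset.sum_neg_distrib]
    refine Finset.sum_congr rfl fun a _ => ?_
    rw [Finset.sum_comm]
    refine Finset.sum_congr rfl fun e _ => ?_
    rw [hTa a e, neg_mul, neg_neg, hT, Matrix.mul_apply, Finset.sum_mul]
    exact Finset.sum_congr rfl fun c _ => by rw [inv_symm_apply hS a c]; ring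
  have e3 : ∑ a, ∑ c, ∑ e, S⁻¹ a c * (A e b * R a e c d) = 0 := by
    simp only [Finset.sum_comm (s := Finset.univ) (t := Finset.univ)
      (f := fun c e => _ * (A e b * R _ e c d))]
    rw [Finset.sum_comm]
    refine Finset.sum_eq_zero fun e _ => ?_
    rw [← mul_zero (A e b), ← hR e d, Finset.mul_sum]
    refine Finset.sum_congr rfl fun a _ => ?_
    rw [Finset.mul_sum]
    exact Finset.sum_congr rfl fun c _ => by ring
  have e4 : ∑ a, ∑ c, ∑ e, S⁻¹ a c * (A e d * R a b c e) = 0 := by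
    simp only [Finset.sum_comm (s := Finset.univ) (t := Finset.univ)
      (f := fun c e => _ * (A e d * R _ b c e))]
    rw [Finset.sum_comm]
    refine Finset.sum_eq_zero fun e _ => ?_
    rw [← mul_zero (A e d), ← hR b e, Finset.mul_sum]
    refine Finset.sum_congr rfl fun a _ => ?_
    rw [Finset.mul_sum]
    exact Finset.sum_congr rfl fun c _ => by ring
  simp only [tensorAct, Finset.mul_sum, mul_add, Finset.sum_add_distrib]
  rw [e1, e2, e3, e4]
  ring

/-- The Schouten tensor. -/
def schouten (G : Coord n → Matrix (Fin n) (Fin n) ℝ) (x : Coord n) :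
    Matrix (Fin n) (Fin n) ℝ :=
  Matrix.of fun a b => 1 / ((n : ℝ) - 2)
    * (ricci G a b x - scalarCurv G x / (2 * ((n : ℝ) - 1)) * G x a b)

theorem LocalCKY.four_le (h : LocalCKY U G Φ) : (4 : ℝ) ≤ n := by exact_mod_cast h.dim

/-- This form separates the curvature from its trace part, to which `tensorAct_kulkarniNomizu`
applies. -/
theorem weyl_eq (h : LocalCKY U G Φ) (a b c d : Fin n) :
    weyl G x a b c d = riemann G a b c d x - kulkarniNomizu (G x) (schouten G x) a b c d := by
  have h1 : (n : ℝ) - 1 ≠ 0 := by linarith [h.four_le]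
  have h2 : (n : ℝ) - 2 ≠ 0 := by linarith [h.four_le]
  simp only [weyl, kulkarniNomizu, schouten, Matrix.of_apply]
  field_simp
  ring

theorem trace_riemann (h : LocalCKY U G Φ) (hx : x ∈ U) (b d : Fin n) :
    ∑ a, ∑ c, (G x)⁻¹ a c * riemann G a b c d x = ricci G b d x := by
  rw [Finset.sum_comm, ricci]
  refine Finset.sum_congr rfl fun c _ => ?_
  simp only [riemann, Finset.mul_sum]
  rw [Finset.sum_comm]
  have : ∀ k, ∑ a, (G x)⁻¹ a c * (G x a k * riemannUp G k b c d x)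
      = (if c = k then 1 else 0) * riemannUp G k b c d x := fun k => by
    rw [← sum_inv_mul (h.det x hx) c k, Finset.sum_mul]
    exact Finset.sum_congr rfl fun a _ => by rw [inv_symm_apply (h.symm x hx) a c]; ring
  simp [this]

theorem ricci_symm (h : LocalCKY U G Φ) (hx : x ∈ U) (b d : Fin n) :
    ricci G b d x = ricci G d b x := by
  rw [← trace_riemann h hx, ← trace_riemann h hx, Finset.sum_comm]
  exact Finset.sum_congr rfl fun c _ => Finset.sum_congr rfl fun a _ => by
    rw [riemann_pair_symm h hx a b c d, inv_symm_apply (h.symm x hx) a c]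

theorem schouten_symm (h : LocalCKY U G Φ) (hx : x ∈ U) : (schouten G x).IsSymm := by
  ext a b
  simp only [Matrix.transpose_apply, schouten, Matrix.of_apply]
  rw [ricci_symm h hx b a, (h.symm x hx).apply a b]

theorem trace_weyl (h : LocalCKY U G Φ) (hx : x ∈ U) (b d : Fin n) :
    ∑ a, ∑ c, (G x)⁻¹ a c * weyl G x a b c d = 0 := by
  have h1 : (n : ℝ) - 1 ≠ 0 := by linarith [h.four_le]
  have h2 : (n : ℝ) - 2 ≠ 0 := by linarith [h.four_le]
  simp only [weyl_eq h, mul_sub, Finset.sum_sub_distrib]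
  rw [trace_riemann h hx,
    trace_kulkarniNomizu (h.symm x hx) (h.det x hx)]
  have : ∑ a, ∑ c, (G x)⁻¹ a c * schouten G x a c = 1 / ((n : ℝ) - 2)
      * (scalarCurv G x - scalarCurv G x / (2 * ((n : ℝ) - 1)) * n) := by
    have e : scalarCurv G x - scalarCurv G x / (2 * ((n : ℝ) - 1)) * n
        = ∑ a, ∑ c, (G x)⁻¹ a c * ricci G a c x
          - scalarCurv G x / (2 * ((n : ℝ) - 1)) * ∑ a, ∑ c, (G x)⁻¹ a c * G x a c := by
      rw [sum_inv_mul_self (h.symm x hx) (h.det x hx)]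
      rfl
    rw [e]
    simp only [schouten, Matrix.of_apply]
    simp only [Finset.mul_sum, ← Finset.sum_sub_distrib]
    exact Finset.sum_congr rfl fun c _ => Finset.sum_congr rfl fun a _ => by ring
  rw [this]
  simp only [schouten, Matrix.of_apply]
  field_simp
  ring

/-- The Weyl tensor is invariant under the derivation action of a conformal Killing-Yano
`2`-form. -/
theorem tensorAct_weyl (h : LocalCKY U G Φ) (hx : x ∈ U) (a b c d : Fin n) :
    tensorAct ((G x)⁻¹ * Φ x) (weyl G x) a b c d = 0 := by
  obtain ⟨Ω, N, hΩ, hN, hR⟩ := tensorAct_riemann h hx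
  have hS := h.symm x hx
  have hP := schouten_symm h hx
  set A := (G x)⁻¹ * Φ x with hA
  have hGA : G x * A = Φ x :=
    Matrix.mul_nonsing_inv_cancel_left _ _ (isUnit_iff_ne_zero.2 (h.det x hx))
  set Q := A.transpose * schouten G x + schouten G x * A with hQ
  have hQs : Q.IsSymm := by
    rw [Matrix.IsSymm, hQ, Matrix.transpose_add, Matrix.transpose_mul A.transpose,
      Matrix.transpose_mul _ A, Matrix.transpose_transpose, hP, add_comm]
  have hW : weyl G x = fun a b c d => riemann G a b c d x
      - kulkarniNomizu (G x) (schouten G x) a b c d := by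
    funext a b c d
    exact weyl_eq h a b c d
  have hE : ∀ a b c d, tensorAct A (weyl G x) a b c d
      = Ω a b c d + kulkarniNomizu (G x) (N - Q) a b c d := by
    intro a b c d
    rw [hW, tensorAct_sub A (fun a b c d => riemann G a b c d x), hR,
      tensorAct_kulkarniNomizu hS hP (h.alt x hx) hGA, ← hQ]
    simp only [kulkarniNomizu, Matrix.sub_apply]
    ring
  have hNQ : (N - Q).IsSymm := hN.sub hQs
  have hB : ∀ a b c d, weyl G x a b c d + weyl G x a c d b + weyl G x a d b c = 0 := by
    intro a b c d
    simp only [weyl_eq h]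
    linarith [riemann_bianchi h.isOpen h.symm hx a b c d, kulkarniNomizu_bianchi hS hP a b c d]
  -- The cyclic sum of A·C vanishes, as does that of the Kulkarni-Nomizu term, while Ω is cyclically
  -- invariant: hence 3 Ω = 0.
  have hΩ0 : ∀ a b c d, Ω a b c d = 0 := by
    intro a b c d
    have e := tensorAct_bianchi (A := A) hB a b c d
    rw [hE, hE, hE, hΩ a b c d, ← hΩ a d b c] at e
    linarith [kulkarniNomizu_bianchi hS hNQ a b c d]
  have hE' : ∀ a b c d, tensorAct A (weyl G x) a b c d
      = kulkarniNomizu (G x) (N - Q) a b c d := fun a b c d => by rw [hE, hΩ0, zero_add]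
  have hn := h.four_le
  set t := ∑ a, ∑ c, (G x)⁻¹ a c * (N - Q) a c with ht
  -- Both sides are the trace of A·C, which is zero because C is trace-free.
  have hT : ∀ b d, ((n : ℝ) - 2) * (N - Q) b d + t * G x b d = 0 := by
    intro b d
    rw [ht, ← trace_kulkarniNomizu hS (h.det x hx),
      ← trace_tensorAct hS (h.alt x hx) (trace_weyl h hx) b d]
    simp only [← hA, hE']
  -- A second trace gives (2n - 2) t = 0.
  have ht0 : t = 0 := by
    have : ((n : ℝ) - 2) * t + t * n = 0 := by
      have e : ((n : ℝ) - 2) * t + t * ∑ a, ∑ c, (G x)⁻¹ a c * G x a c = 0 := by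
        rw [ht]
        simp only [Finset.mul_sum, ← Finset.sum_add_distrib]
        refine Finset.sum_eq_zero fun a _ => Finset.sum_eq_zero fun c _ => ?_
        rw [← mul_zero ((G x)⁻¹ a c), ← hT a c]
        ring
      rwa [sum_inv_mul_self hS (h.det x hx)] at e
    have h2 : (2 * (n : ℝ) - 2) * t = 0 := by linarith
    rcases mul_eq_zero.1 h2 with h3 | h3
    · linarith
    · exact h3
  have hz : ∀ b d, (N - Q) b d = 0 := by
    intro b d
    have e := hT b d
    rw [ht0, zero_mul, add_zero] at e
    rcases mul_eq_zero.1 e with h3 | h3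
    · linarith
    · exact h3
  rw [hE', kulkarniNomizu, hz, hz, hz, hz]
  ring

end WeylInvariance

/-! ### Complex multilinear extensions -/

section Multilinear

variable {n : ℕ}

/-- The complexification of a real matrix. -/
abbrev complexify (G : Matrix (Fin n) (Fin n) ℝ) : Matrix (Fin n) (Fin n) ℂ :=
  G.map fun r : ℝ => (r : ℂ)

theorem complexify_mul (A B : Matrix (Fin n) (Fin n) ℝ) :
    complexify (A * B) = complexify A * complexify B :=
  Matrix.map_mul (f := Complex.ofRealHom)

theorem det_complexify (A : Matrix (Fin n) (Fin n) ℝ) :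
    (complexify A).det = (A.det : ℂ) :=
  (RingHom.map_det Complex.ofRealHom A).symm

theorem bilin_eq (G : Matrix (Fin n) (Fin n) ℝ) (u v : Fin n → ℂ) :
    bilin G u v = u ⬝ᵥ (complexify G).mulVec v := by
  simp only [bilin, dotProduct, Matrix.mulVec, Matrix.map_apply, Finset.mul_sum]
  exact Finset.sum_congr rfl fun i _ => Finset.sum_congr rfl fun j _ => by ring

theorem bilin_comm {G : Matrix (Fin n) (Fin n) ℝ} (hG : G.IsSymm) (u v : Fin n → ℂ) :
    bilin G u v = bilin G v u := by
  simp only [bilin]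
  rw [Finset.sum_comm]
  exact Finset.sum_congr rfl fun i _ => Finset.sum_congr rfl fun j _ => by
    rw [hG.apply i j]; ring

theorem bilin_smul_right (G : Matrix (Fin n) (Fin n) ℝ) (c : ℂ) (u v : Fin n → ℂ) :
    bilin G u (c • v) = c * bilin G u v := by
  simp [bilin_eq, Matrix.mulVec_smul]

theorem bilin_smul_left (G : Matrix (Fin n) (Fin n) ℝ) (c : ℂ) (u v : Fin n → ℂ) :
    bilin G (c • u) v = c * bilin G u v := by
  simp [bilin_eq]

theorem bilin_add_right (G : Matrix (Fin n) (Fin n) ℝ) (u v w : Fin n → ℂ) :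
    bilin G u (v + w) = bilin G u v + bilin G u w := by
  simp only [bilin_eq, Matrix.mulVec_add, dotProduct_add]

theorem bilin_add_left (G : Matrix (Fin n) (Fin n) ℝ) (u v w : Fin n → ℂ) :
    bilin G (u + v) w = bilin G u w + bilin G v w := by
  simp only [bilin_eq, add_dotProduct]

theorem bilin_star (G : Matrix (Fin n) (Fin n) ℝ) (u v : Fin n → ℂ) :
    bilin G (star u) (star v) = star (bilin G u v) := by
  simp [bilin, Complex.conj_ofReal]

theorem bilin_sum_left {ι : Type*} [Fintype ι] (G : Matrix (Fin n) (Fin n) ℝ) (x : ι → ℂ)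
    (u : ι → Fin n → ℂ) (v : Fin n → ℂ) :
    bilin G (∑ a, x a • u a) v = ∑ a, x a * bilin G (u a) v := by
  simp [bilin_eq, sum_dotProduct]

theorem bilin_sum_right {ι : Type*} [Fintype ι] (G : Matrix (Fin n) (Fin n) ℝ) (x : ι → ℂ)
    (u : ι → Fin n → ℂ) (v : Fin n → ℂ) :
    bilin G v (∑ a, x a • u a) = ∑ a, x a * bilin G v (u a) := by
  simp [bilin_eq, Matrix.mulVec_sum, Matrix.mulVec_smul, dotProduct_sum]

variable (W : Fin n → Fin n → Fin n → Fin n → ℝ) (u v w z : Fin n → ℂ)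

theorem quad_swap_fst : quad W u v w z = quad (fun a b c d => W b a c d) v u w z := by
  simp only [quad]
  rw [Finset.sum_comm]
  exact Finset.sum_congr rfl fun i _ => Finset.sum_congr rfl fun j _ =>
    Finset.sum_congr rfl fun k _ => Finset.sum_congr rfl fun l _ => by ring

theorem quad_swap_mid : quad W u v w z = quad (fun a b c d => W a c b d) u w v z := by
  simp only [quad]
  refine Finset.sum_congr rfl fun i _ => ?_
  rw [Finset.sum_comm]
  exact Finset.sum_congr rfl fun j _ =>
    Finset.sum_congr rfl fun k _ => Finset.sum_congr rfl fun l _ => by ring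

theorem quad_swap_snd : quad W u v w z = quad (fun a b c d => W a b d c) u v z w := by
  simp only [quad]
  refine Finset.sum_congr rfl fun i _ => Finset.sum_congr rfl fun j _ => ?_
  rw [Finset.sum_comm]
  exact Finset.sum_congr rfl fun k _ => Finset.sum_congr rfl fun l _ => by ring

theorem quad_neg : quad (fun a b c d => -W a b c d) u v w z = -quad W u v w z := by
  simp [quad]

theorem quad_add (R : Fin n → Fin n → Fin n → Fin n → ℝ) :
    quad (fun a b c d => W a b c d + R a b c d) u v w z = quad W u v w z + quad R u v w z := by
  simp only [quad, Complex.ofReal_add, add_mul, Finset.sum_add_distrib]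

theorem quad_eq_sum_fst : quad W u v w z
    = ∑ i, u i * ∑ j, ∑ k, ∑ l, (W i j k l : ℂ) * v j * w k * z l := by
  simp only [quad, Finset.mul_sum]
  exact Finset.sum_congr rfl fun i _ => Finset.sum_congr rfl fun j _ =>
    Finset.sum_congr rfl fun k _ => Finset.sum_congr rfl fun l _ => by ring

theorem quad_sum_fst {ι : Type*} [Fintype ι] (x : ι → ℂ) (y : ι → Fin n → ℂ) :
    quad W (∑ a, x a • y a) v w z = ∑ a, x a * quad W (y a) v w z := by
  simp only [quad_eq_sum_fst, Finset.sum_apply, Pi.smul_apply, smul_eq_mul, Finset.sum_mul]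
  rw [Finset.sum_comm]
  refine Finset.sum_congr rfl fun a _ => ?_
  rw [Finset.mul_sum]
  exact Finset.sum_congr rfl fun i _ => by ring

theorem quad_sum_snd {ι : Type*} [Fintype ι] (x : ι → ℂ) (y : ι → Fin n → ℂ) :
    quad W u (∑ a, x a • y a) w z = ∑ a, x a * quad W u (y a) w z := by
  simp only [fun y => quad_swap_fst W u y w z, quad_sum_fst]

theorem quad_sum_trd {ι : Type*} [Fintype ι] (x : ι → ℂ) (y : ι → Fin n → ℂ) :
    quad W u v (∑ a, x a • y a) z = ∑ a, x a * quad W u v (y a) z := by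
  simp only [fun y => quad_swap_mid W u v y z, quad_sum_snd]

theorem quad_sum_fth {ι : Type*} [Fintype ι] (x : ι → ℂ) (y : ι → Fin n → ℂ) :
    quad W u v w (∑ a, x a • y a) = ∑ a, x a * quad W u v w (y a) := by
  simp only [fun y => quad_swap_snd W u v w y, quad_sum_trd]

theorem quad_smul (a b c d : ℂ) :
    quad W (a • u) (b • v) (c • w) (d • z) = a * b * c * d * quad W u v w z := by
  simp only [quad, Finset.mul_sum, Pi.smul_apply, smul_eq_mul]
  exact Finset.sum_congr rfl fun i _ => Finset.sum_congr rfl fun j _ =>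
    Finset.sum_congr rfl fun k _ => Finset.sum_congr rfl fun l _ => by ring

theorem quad_contract_fst (A : Matrix (Fin n) (Fin n) ℝ) :
    quad (fun a b c d => ∑ e, A e a * W e b c d) u v w z
      = quad W ((complexify A).mulVec u) v w z := by
  have h : ∀ i, ∑ j, ∑ k, ∑ l, ((∑ e, A e i * W e j k l : ℝ) : ℂ) * v j * w k * z l
      = ∑ e, (A e i : ℂ) * ∑ j, ∑ k, ∑ l, (W e j k l : ℂ) * v j * w k * z l := by
    intro i
    symm
    simp only [Finset.mul_sum]
    rw [Finset.sum_comm]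
    refine Finset.sum_congr rfl fun j _ => ?_
    rw [Finset.sum_comm]
    refine Finset.sum_congr rfl fun k _ => ?_
    rw [Finset.sum_comm]
    refine Finset.sum_congr rfl fun l _ => ?_
    push_cast
    simp only [Finset.sum_mul]
    exact Finset.sum_congr rfl fun e _ => by ring
  simp only [quad_eq_sum_fst, h, Matrix.mulVec, dotProduct, Matrix.map_apply, Finset.sum_mul]
  rw [Finset.sum_comm]
  refine Finset.sum_congr rfl fun i _ => ?_
  rw [Finset.mul_sum]
  exact Finset.sum_congr rfl fun e _ => by ring

theorem quad_tensorAct (A : Matrix (Fin n) (Fin n) ℝ) :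
    quad (tensorAct A W) u v w z
      = quad W ((complexify A).mulVec u) v w z + quad W u ((complexify A).mulVec v) w z
        + quad W u v ((complexify A).mulVec w) z + quad W u v w ((complexify A).mulVec z) := by
  have h : tensorAct A W = fun a b c d => (∑ e, A e a * W e b c d) + (∑ e, A e b * W a e c d)
      + (∑ e, A e c * W a b e d) + (∑ e, A e d * W a b c e) := by
    funext a b c d
    simp only [tensorAct, Finset.sum_add_distrib]
  rw [h, quad_add (fun a b c d => (∑ e, A e a * W e b c d) + (∑ e, A e b * W a e c d)
      + (∑ e, A e c * W a b e d)),
    quad_add (fun a b c d => (∑ e, A e a * W e b c d) + (∑ e, A e b * W a e c d)),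
    quad_add (fun a b c d => ∑ e, A e a * W e b c d), quad_contract_fst]
  -- Each of the other slots is transposed to the first one, contracted there, and transposed back.
  congr 1
  · congr 1
    · congr 1
      rw [quad_swap_fst, quad_contract_fst (fun a b c d => W b a c d), ← quad_swap_fst W]
    · rw [quad_swap_mid, quad_swap_fst, quad_contract_fst (fun a b c d => W b c a d),
        ← quad_swap_fst (fun a b c d => W a c b d), ← quad_swap_mid W]
  · rw [quad_swap_snd, quad_swap_mid, quad_swap_fst,
      quad_contract_fst (fun a b c d => W b c d a),
      ← quad_swap_fst (fun a b c d => W a c d b),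
      ← quad_swap_mid (fun a b c d => W a b d c), ← quad_swap_snd W]

variable {W}

theorem quad_eq_zero_fst (hW : ∀ a b c d, W a b c d = -W b a c d) : quad W u u w z = 0 := by
  have h : quad W u u w z = -quad W u u w z := by
    rw [← quad_neg, quad_swap_fst]
    congr 1
    funext a b c d
    exact hW b a c d
  exact self_eq_neg.1 h

theorem quad_eq_zero_snd (hW : ∀ a b c d, W a b c d = -W a b d c) : quad W u v w w = 0 := by
  have h : quad W u v w w = -quad W u v w w := by
    rw [← quad_neg, quad_swap_snd]
    congr 1
    funext a b c d
    exact hW a b d c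
  exact self_eq_neg.1 h

end Multilinear

/-! ### Eigenvectors of φ and the eigenvalue sum rule -/

section Eigen

variable {n : ℕ} {G Φ : Matrix (Fin n) (Fin n) ℝ} {α β γ δ : ℂ} {u v w z : Fin n → ℂ}

/-- `u` satisfies the eigenvector equation `φ u = α g u`, with index lowered. -/
def IsEigen (G Φ : Matrix (Fin n) (Fin n) ℝ) (α : ℂ) (u : Fin n → ℂ) : Prop :=
  (complexify Φ).mulVec u = α • (complexify G).mulVec u

theorem mulVec_complexify_injective (hdet : G.det ≠ 0) :
    Function.Injective (complexify G).mulVec :=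
  Matrix.mulVec_injective_of_isUnit ((Matrix.isUnit_iff_isUnit_det _).2 (by
    rw [det_complexify]
    exact isUnit_iff_ne_zero.2 (by exact_mod_cast hdet)))

theorem complexify_mul_raise (hdet : G.det ≠ 0) :
    complexify G * complexify (G⁻¹ * Φ) = complexify Φ := by
  rw [← complexify_mul, Matrix.mul_nonsing_inv_cancel_left _ _ (isUnit_iff_ne_zero.2 hdet)]

theorem IsEigen.mulVec_raise (hdet : G.det ≠ 0) (hu : IsEigen G Φ α u) :
    (complexify (G⁻¹ * Φ)).mulVec u = α • u := by
  apply mulVec_complexify_injective hdet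
  rw [Matrix.mulVec_mulVec, complexify_mul_raise hdet, hu, Matrix.mulVec_smul]

theorem mem_eigenvalues_iff (hdet : G.det ≠ 0) :
    α ∈ eigenvalues G Φ ↔ (α • complexify G - complexify Φ).det = 0 := by
  have h : α • complexify G - complexify Φ
      = complexify G * (algebraMap ℂ _ α - complexify (G⁻¹ * Φ)) := by
    rw [mul_sub, complexify_mul_raise hdet, ← Algebra.commutes, ← Algebra.smul_def]
  have hd : (complexify G).det ≠ 0 := by
    rw [det_complexify]; exact_mod_cast hdet
  rw [h, Matrix.det_mul, mul_eq_zero, or_iff_right hd, eigenvalues, spectrum.mem_iff,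
    Matrix.isUnit_iff_isUnit_det, isUnit_iff_ne_zero, not_not]

theorem mem_eigenvalues_iff_exists (hdet : G.det ≠ 0) :
    α ∈ eigenvalues G Φ ↔ ∃ u, u ≠ 0 ∧ IsEigen G Φ α u := by
  rw [mem_eigenvalues_iff hdet, ← Matrix.exists_mulVec_eq_zero_iff]
  simp only [Matrix.sub_mulVec, Matrix.smul_mulVec, sub_eq_zero, IsEigen, eq_comm]

theorem neg_mem_eigenvalues (hdet : G.det ≠ 0) (hG : G.IsSymm) (hΦ : Φ.transpose = -Φ)
    (hα : α ∈ eigenvalues G Φ) : -α ∈ eigenvalues G Φ := by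
  rw [mem_eigenvalues_iff hdet] at hα ⊢
  have h : -α • complexify G - complexify Φ
      = -(α • complexify G - complexify Φ).transpose := by
    have h1 : (complexify Φ).transpose = -complexify Φ := by
      rw [← Matrix.transpose_map, hΦ]
      ext i j
      simp
    have h2 : (complexify G).transpose = complexify G := by
      rw [← Matrix.transpose_map, hG]
    rw [Matrix.transpose_sub, Matrix.transpose_smul, h1, h2, neg_smul]
    abel
  rw [h, Matrix.det_neg, Matrix.det_transpose, hα, mul_zero]

/-- Skewness of φ with respect to g gives (α + β) g(u, v) = 0. -/
theorem IsEigen.bilin_eq_zero (hG : G.IsSymm) (hΦ : Φ.transpose = -Φ) (hu : IsEigen G Φ α u)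
    (hv : IsEigen G Φ β v) (h : α + β ≠ 0) : bilin G u v = 0 := by
  have h1 : u ⬝ᵥ (complexify Φ).mulVec v = β * bilin G u v := by
    rw [hv, dotProduct_smul, bilin_eq, smul_eq_mul]
  have h2 : u ⬝ᵥ (complexify Φ).mulVec v = -(α * bilin G u v) := by
    have h3 : complexify Φ = -(complexify Φ).transpose := by
      rw [← Matrix.transpose_map, hΦ]
      ext i j
      simp
    rw [h3, Matrix.neg_mulVec, dotProduct_neg, Matrix.mulVec_transpose, dotProduct_comm,
      ← Matrix.dotProduct_mulVec, hu, dotProduct_smul, ← bilin_eq, bilin_comm hG, smul_eq_mul]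
  have h3 : (α + β) * bilin G u v = 0 := by linear_combination h1.symm.trans h2
  exact (mul_eq_zero.1 h3).resolve_left h

theorem IsEigen.star (hu : IsEigen G Φ α u) :
    IsEigen G Φ ((starRingEnd ℂ) α) (star u) := by
  have h : ∀ B : Matrix (Fin n) (Fin n) ℝ,
      (complexify B).mulVec (Star.star u) = Star.star ((complexify B).mulVec u) := by
    intro B
    ext i
    simp [Matrix.mulVec, dotProduct, Complex.conj_ofReal]
  rw [IsEigen, h, h, hu]
  ext i
  simp

theorem IsEigen.smul (hu : IsEigen G Φ α u) (c : ℂ) : IsEigen G Φ α (c • u) := by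
  rw [IsEigen, Matrix.mulVec_smul, hu, Matrix.mulVec_smul, smul_comm]

/-- On eigenvectors the derivation acts as multiplication by the sum of the eigenvalues, so A·W = 0
becomes (α + β + γ + δ) W(u, v, w, z) = 0. -/
theorem quad_eigen {W : Fin n → Fin n → Fin n → Fin n → ℝ} (hdet : G.det ≠ 0)
    (hW : ∀ a b c d, tensorAct (G⁻¹ * Φ) W a b c d = 0) (hu : IsEigen G Φ α u)
    (hv : IsEigen G Φ β v) (hw : IsEigen G Φ γ w) (hz : IsEigen G Φ δ z)
    (h : α + β + γ + δ ≠ 0) : quad W u v w z = 0 := by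
  have e := quad_tensorAct W u v w z (G⁻¹ * Φ)
  have e0 : quad (tensorAct (G⁻¹ * Φ) W) u v w z = 0 := by simp [quad, hW]
  have s1 := quad_smul W u v w z α 1 1 1
  have s2 := quad_smul W u v w z 1 β 1 1
  have s3 := quad_smul W u v w z 1 1 γ 1
  have s4 := quad_smul W u v w z 1 1 1 δ
  simp only [one_smul, one_mul, mul_one] at s1 s2 s3 s4
  rw [e0, hu.mulVec_raise hdet, hv.mulVec_raise hdet, hw.mulVec_raise hdet,
    hz.mulVec_raise hdet, s1, s2, s3, s4] at e
  have h3 : (α + β + γ + δ) * quad W u v w z = 0 := by linear_combination -e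
  exact (mul_eq_zero.1 h3).resolve_left h

end Eigen

/-! ### Diagonalising null frames and aligned components -/

namespace NullDiagonalFrame

variable {m : ℕ} {G Φ : Matrix (Fin (2 * m)) (Fin (2 * m)) ℝ}

/-- The eigenvalue of `φ` on the frame vector `V a`. -/
def ev (F : NullDiagonalFrame m G Φ) : Fin m ⊕ Fin m → ℂ := Sum.elim (fun μ => -F.eig μ) F.eig

variable (F : NullDiagonalFrame m G Φ)

theorem ev_swap (a : Fin m ⊕ Fin m) : F.ev a.swap = -F.ev a := by
  cases a <;> simp [ev]

theorem swap_ne_self (a : Fin m ⊕ Fin m) : a.swap ≠ a := by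
  cases a <;> simp

theorem mulVec_metric (a : Fin m ⊕ Fin m) :
    (complexify G).mulVec (F.V a) = F.θ a.swap := by
  ext i
  have h : ∀ j, (G i j : ℂ) * F.V a j
      = ∑ b : Fin m ⊕ Fin m, F.θ b.swap i * (F.θ b j * F.V a j) := by
    intro j
    rw [F.metric_eq, Fintype.sum_sum_type, Finset.sum_mul, ← Finset.sum_add_distrib]
    exact Finset.sum_congr rfl fun μ _ => by simp only [Sum.swap_inl, Sum.swap_inr]; ring
  simp only [Matrix.mulVec, dotProduct, Matrix.map_apply, h]
  rw [Finset.sum_comm]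
  simp only [← Finset.mul_sum, F.dual]
  simp

theorem isEigen (a : Fin m ⊕ Fin m) : IsEigen G Φ (F.ev a) (F.V a) := by
  rw [IsEigen, mulVec_metric]
  ext i
  have h : ∀ j, (Φ i j : ℂ) * F.V a j
      = ∑ b : Fin m ⊕ Fin m, F.ev b * F.θ b.swap i * (F.θ b j * F.V a j) := by
    intro j
    rw [F.form_eq, Fintype.sum_sum_type, Finset.sum_mul, ← Finset.sum_add_distrib]
    exact Finset.sum_congr rfl fun μ _ => by
      simp only [Sum.swap_inl, Sum.swap_inr, ev, Sum.elim_inl, Sum.elim_inr]; ring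
  simp only [Matrix.mulVec, dotProduct, Matrix.map_apply, h]
  rw [Finset.sum_comm]
  simp only [← Finset.mul_sum, F.dual]
  simp

theorem bilin_V_left (a : Fin m ⊕ Fin m) (hG : G.IsSymm) (X : Fin (2 * m) → ℂ) :
    bilin G (F.V a) X = ∑ i, F.θ a.swap i * X i := by
  rw [bilin_comm hG, bilin_eq, mulVec_metric, dotProduct_comm]
  rfl

theorem bilin_V (a b : Fin m ⊕ Fin m) :
    bilin G (F.V a) (F.V b) = if b.swap = a then 1 else 0 := by
  rw [bilin_eq, mulVec_metric, dotProduct_comm, ← F.dual]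
  rfl

/-- The coefficient of `V a` is θᵃ(X), and θᵃ is the metric dual of the partner vector `V a.swap`.
-/
theorem expand (hG : G.IsSymm) (X : Fin (2 * m) → ℂ) :
    X = ∑ a, bilin G (F.V a.swap) X • F.V a := by
  have h1 : (Matrix.of F.θ) * (Matrix.of F.V).transpose = 1 := by
    ext a b
    rw [Matrix.mul_apply, Matrix.one_apply, ← F.dual a b]
    rfl
  have h2 : (Matrix.of F.V).transpose * (Matrix.of F.θ) = 1 :=
    (Matrix.mul_eq_one_comm_of_card_eq _ _ _ (by simp [two_mul])).1 h1
  calc X = ((Matrix.of F.V).transpose * (Matrix.of F.θ)).mulVec X := by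
        rw [h2, Matrix.one_mulVec]
    _ = _ := by
        rw [← Matrix.mulVec_mulVec]
        ext i
        simp only [F.bilin_V_left _ hG, Sum.swap_swap, Matrix.mulVec, dotProduct,
          Matrix.transpose_apply, Matrix.of_apply, Finset.sum_apply, Pi.smul_apply, smul_eq_mul]
        exact Finset.sum_congr rfl fun a _ => mul_comm _ _

theorem V_ne_zero (a : Fin m ⊕ Fin m) : F.V a ≠ 0 := by
  intro h
  have := F.dual a a
  simp [h] at this

/-- Invertibility of the component matrix of the metric is forced by the number of eigenvalues. -/
theorem det_ne_zero_of_distinct (hm : 2 ≤ m) (hd : NondegenerateDistinct G Φ) : G.det ≠ 0 := by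
  intro h
  have h1 : eigenvalues G Φ ⊆ {0} := by
    intro α hα
    -- The matrix inverse of a singular matrix is 0 by convention, which would leave 0 as the only
    -- eigenvalue, against 2m ≥ 4 of them.
    have h0 : (G⁻¹ * Φ).map (fun r : ℝ => (r : ℂ)) = 0 := by
      rw [Matrix.nonsing_inv_apply_not_isUnit _ (by rw [h]; simp), Matrix.zero_mul]
      ext i j
      simp
    have : Nonempty (Fin (2 * m)) := ⟨⟨0, by omega⟩⟩
    rw [eigenvalues, h0, spectrum.zero_eq] at hα
    exact hα
  have h2 := Set.ncard_le_ncard h1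
  rw [hd.2, Set.ncard_singleton] at h2
  omega

theorem eigenvalues_eq (hdet : G.det ≠ 0) (hG : G.IsSymm) :
    eigenvalues G Φ = Set.range F.ev := by
  ext α
  rw [mem_eigenvalues_iff_exists hdet]
  constructor
  · rintro ⟨u, hu, hα⟩
    by_contra hn
    apply hu
    rw [F.expand hG u]
    refine Finset.sum_eq_zero fun a _ => ?_
    have e1 := hα.mulVec_raise hdet
    have e2 : (complexify (G⁻¹ * Φ)).mulVec u
        = ∑ a, (F.ev a * bilin G (F.V a.swap) u) • F.V a := by
      conv_lhs => rw [F.expand hG u]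
      rw [Matrix.mulVec_sum]
      exact Finset.sum_congr rfl fun b _ => by
        rw [Matrix.mulVec_smul, (F.isEigen b).mulVec_raise hdet, smul_smul,
          mul_comm (F.ev b)]
    have e3 := congrArg (bilin G (F.V a.swap)) (e1.symm.trans e2)
    rw [bilin_smul_right, bilin_sum_right] at e3
    simp only [F.bilin_V, (Function.Involutive.injective Sum.swap_swap).eq_iff] at e3
    simp only [mul_ite, mul_one, mul_zero, Finset.sum_ite_eq', Finset.mem_univ, if_true] at e3
    have e4 : (α - F.ev a) * bilin G (F.V a.swap) u = 0 := by linear_combination e3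
    rcases mul_eq_zero.1 e4 with h | h
    · exact absurd ⟨a, (sub_eq_zero.1 h).symm⟩ hn
    · rw [h, zero_smul]
  · rintro ⟨a, rfl⟩
    exact ⟨F.V a, F.V_ne_zero a, F.isEigen a⟩

theorem ev_injective (hdet : G.det ≠ 0) (hG : G.IsSymm) (hd : NondegenerateDistinct G Φ) :
    Function.Injective F.ev := by
  have h1 : (Finset.univ.image F.ev).card = (Finset.univ : Finset (Fin m ⊕ Fin m)).card := by
    rw [← Set.ncard_coe_finset, Finset.coe_image, Finset.coe_univ, Set.image_univ,
      ← F.eigenvalues_eq hdet hG, hd.2]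
    simp [two_mul]
  exact fun a b h => Finset.injOn_of_card_image_eq h1 (by simp) (by simp) h

/-- In the expansion of `u`, the coefficient of `V b` pairs `u` with an eigenvector of eigenvalue
-`F.ev b`, and vanishes unless `F.ev b` = `F.ev a`. -/
theorem isEigen_eq_smul (hdet : G.det ≠ 0) (hG : G.IsSymm) (hΦ : Φ.transpose = -Φ)
    (hd : NondegenerateDistinct G Φ) {a : Fin m ⊕ Fin m} {u : Fin (2 * m) → ℂ}
    (hu : IsEigen G Φ (F.ev a) u) : ∃ c : ℂ, u = c • F.V a := by
  refine ⟨bilin G (F.V a.swap) u, ?_⟩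
  conv_lhs => rw [F.expand hG u]
  refine Finset.sum_eq_single a (fun b _ hb => ?_) (by simp)
  rw [(F.isEigen b.swap).bilin_eq_zero hG hΦ hu, zero_smul]
  rw [ev_swap]
  intro h
  exact hb (F.ev_injective hdet hG hd (by linear_combination -h))

theorem ev_add_ne_zero (hdet : G.det ≠ 0) (hG : G.IsSymm)
    (hd : NondegenerateDistinct G Φ) {a b : Fin m ⊕ Fin m} (h : b ≠ a.swap) :
    F.ev a + F.ev b ≠ 0 := by
  intro h0
  exact h (F.ev_injective hdet hG hd (by rw [ev_swap]; linear_combination h0))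

theorem ev_ne_zero (hdet : G.det ≠ 0) (hG : G.IsSymm)
    (hd : NondegenerateDistinct G Φ) (a : Fin m ⊕ Fin m) : F.ev a ≠ 0 := by
  intro h
  exact F.ev_add_ne_zero hdet hG hd (swap_ne_self a).symm (by rw [h, add_zero])

/-- The components `C(V a, V b, V c, V d)` with no index dual to `a` vanish. -/
def Aligned (W : Fin (2 * m) → Fin (2 * m) → Fin (2 * m) → Fin (2 * m) → ℝ)
    (a : Fin m ⊕ Fin m) : Prop :=
  ∀ b c d, b ≠ a.swap → c ≠ a.swap → d ≠ a.swap → quad W (F.V a) (F.V b) (F.V c) (F.V d) = 0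

variable {F} {W : Fin (2 * m) → Fin (2 * m) → Fin (2 * m) → Fin (2 * m) → ℝ}
  {a : Fin m ⊕ Fin m}

/-- A vector orthogonal to `V a` has no component along the dual vector `V a.swap`, so only
components covered by `Aligned` occur. -/
theorem Aligned.quad_eq_zero (h : F.Aligned W a) (hG : G.IsSymm) {X Y Z : Fin (2 * m) → ℂ}
    (hX : bilin G (F.V a) X = 0) (hY : bilin G (F.V a) Y = 0) (hZ : bilin G (F.V a) Z = 0) :
    quad W (F.V a) X Y Z = 0 := by
  rw [F.expand hG X, F.expand hG Y, F.expand hG Z, quad_sum_snd]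
  refine Finset.sum_eq_zero fun b _ => ?_
  by_cases hb : b = a.swap
  · rw [hb, Sum.swap_swap, hX, zero_mul]
  refine mul_eq_zero_of_right _ ?_
  rw [quad_sum_trd]
  refine Finset.sum_eq_zero fun c _ => ?_
  by_cases hc : c = a.swap
  · rw [hc, Sum.swap_swap, hY, zero_mul]
  refine mul_eq_zero_of_right _ ?_
  rw [quad_sum_fth]
  refine Finset.sum_eq_zero fun d _ => ?_
  by_cases hd : d = a.swap
  · rw [hd, Sum.swap_swap, hZ, zero_mul]
  exact mul_eq_zero_of_right _ (h b c d hb hc hd)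

variable (F) in
theorem bilin_V_self (a : Fin m ⊕ Fin m) : bilin G (F.V a) (F.V a) = 0 := by
  rw [bilin_V, if_neg (swap_ne_self a)]

theorem Aligned.isWAND (h : F.Aligned W a) (hG : G.IsSymm) : IsWAND G W (F.V a) :=
  ⟨F.V_ne_zero a, F.bilin_V_self a, fun _ _ hX hY => h.quad_eq_zero hG hX (F.bilin_V_self a) hY⟩

theorem Aligned.noPositiveBoost (h : F.Aligned W a) (hdet : G.det ≠ 0) (hG : G.IsSymm)
    (hd : NondegenerateDistinct G Φ) (hW : ∀ a b c d, tensorAct (G⁻¹ * Φ) W a b c d = 0) :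
    NoPositiveBoost G W (F.V a) (F.V a.swap) := by
  intro X Y Z hX hX' hY _ hZ _
  refine ⟨h.quad_eq_zero hG hX (F.bilin_V_self a) hY, ?_, h.quad_eq_zero hG hX hY hZ⟩
  -- In C(V_a, V_{a.swap}, V_a, V_b) the first two eigenvalues cancel, and the sum of the others is
  -- non-zero unless `b` is dual to `a`. Alignment plays no part in this component.
  rw [F.expand hG X, quad_sum_fth]
  refine Finset.sum_eq_zero fun b _ => ?_
  by_cases hb : b = a.swap
  · rw [hb, Sum.swap_swap, hX, zero_mul]
  refine mul_eq_zero_of_right _ (quad_eigen hdet hW (F.isEigen a) (F.isEigen a.swap)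
    (F.isEigen a) (F.isEigen b) ?_)
  rw [ev_swap, add_neg_cancel, zero_add]
  exact F.ev_add_ne_zero hdet hG hd hb

theorem Aligned.isTypeDPair (h : F.Aligned W a) (h' : F.Aligned W a.swap) (hdet : G.det ≠ 0)
    (hG : G.IsSymm) (hd : NondegenerateDistinct G Φ)
    (hW : ∀ a b c d, tensorAct (G⁻¹ * Φ) W a b c d = 0) :
    IsTypeDPair G W (F.V a) (F.V a.swap) := by
  refine ⟨F.bilin_V_self a, F.bilin_V_self _, ?_, h.noPositiveBoost hdet hG hd hW, ?_⟩
  · rw [bilin_V, if_pos (Sum.swap_swap a)]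
  · have := h'.noPositiveBoost hdet hG hd hW
    rwa [Sum.swap_swap] at this

end NullDiagonalFrame

/-! ### Existence of a diagonalising null frame -/

section Existence

variable {m : ℕ} {G Φ : Matrix (Fin (2 * m)) (Fin (2 * m)) ℝ}

/-- A half-plane containing exactly one of `α`, `-α` for each `α ≠ 0`. -/
def HalfPlane (α : ℂ) : Prop := 0 < α.re ∨ (α.re = 0 ∧ 0 < α.im)

theorem halfPlane_neg {α : ℂ} (hα : α ≠ 0) : HalfPlane (-α) ↔ ¬HalfPlane α := by
  have h : α.re ≠ 0 ∨ α.im ≠ 0 := by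
    by_contra! h
    exact hα (Complex.ext h.1 h.2)
  simp only [HalfPlane, Complex.neg_re, Complex.neg_im, not_or, not_and, not_lt, neg_pos,
    neg_eq_zero]
  constructor
  · rintro (h1 | ⟨h1, h2⟩)
    · exact ⟨h1.le, fun h => absurd h h1.ne⟩
    · exact ⟨h1.le, fun _ => h2.le⟩
  · rintro ⟨h1, h2⟩
    rcases h1.lt_or_eq with h3 | h3
    · exact Or.inl h3
    · refine Or.inr ⟨h3, lt_of_le_of_ne (h2 h3) ?_⟩
      rcases h with h | h
      · exact absurd h3 h
      · exact h

theorem bilin_nondeg (hdet : G.det ≠ 0) {u : Fin (2 * m) → ℂ}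
    (h : ∀ v, bilin G v u = 0) : u = 0 := by
  apply mulVec_complexify_injective hdet
  rw [Matrix.mulVec_zero]
  ext i
  have := h (Pi.single i 1)
  rwa [bilin_eq, single_one_dotProduct] at this

theorem exists_eigenvalue_labelling (hm : 2 ≤ m) (hdet : G.det ≠ 0) (hG : G.IsSymm)
    (hΦ : Φ.transpose = -Φ) (hd : NondegenerateDistinct G Φ) (h0 : 0 ∉ eigenvalues G Φ) :
    ∃ lam : Fin m → ℂ, (∀ μ, lam μ ∈ eigenvalues G Φ) ∧ (∀ μ, HalfPlane (lam μ)) ∧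
      Function.Injective lam := by
  classical
  -- `Set.ncard` is 0 on infinite sets, so a non-zero value certifies finiteness.
  have hfin : (eigenvalues G Φ).Finite := Set.finite_of_ncard_ne_zero (by rw [hd.2]; omega)
  set S := hfin.toFinset with hS
  have hcard : S.card = 2 * m := by
    rw [← hd.2, Set.ncard_eq_toFinset_card _ hfin]
  have hmem : ∀ α, α ∈ S ↔ α ∈ eigenvalues G Φ := fun α => hfin.mem_toFinset
  -- The spectrum is symmetric under α ↦ -α, which exchanges the two half-planes; each therefore
  -- contains m eigenvalues.
  have hneg : (S.filter fun α => ¬HalfPlane α).card = (S.filter HalfPlane).card := by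
    refine Finset.card_bij (fun α _ => -α) ?_ (fun a _ b _ h => neg_injective h) ?_
    · intro α hα
      rw [Finset.mem_filter, hmem] at hα ⊢
      refine ⟨neg_mem_eigenvalues hdet hG hΦ hα.1, (halfPlane_neg ?_).2 hα.2⟩
      rintro rfl
      exact h0 hα.1
    · intro α hα
      rw [Finset.mem_filter, hmem] at hα
      refine ⟨-α, ?_, neg_neg α⟩
      rw [Finset.mem_filter, hmem]
      refine ⟨neg_mem_eigenvalues hdet hG hΦ hα.1, fun h => ?_⟩
      rw [halfPlane_neg (by rintro rfl; exact h0 hα.1)] at h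
      exact h hα.2
  have hhalf : (S.filter HalfPlane).card = m := by
    have := Finset.card_filter_add_card_filter_not (s := S) HalfPlane
    omega
  let e := (S.filter HalfPlane).equivFinOfCardEq hhalf
  refine ⟨fun μ => (e.symm μ : ℂ), fun μ => ?_, fun μ => ?_,
    Subtype.val_injective.comp e.symm.injective⟩
  · have := (e.symm μ).2
    rw [Finset.mem_filter, hmem] at this
    exact this.1
  · have := (e.symm μ).2
    rw [Finset.mem_filter] at this
    exact this.2

theorem zero_notMem_eigenvalues (hdet : G.det ≠ 0) (hd : NondegenerateDistinct G Φ) :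
    0 ∉ eigenvalues G Φ := by
  rw [mem_eigenvalues_iff hdet, zero_smul, zero_sub, Matrix.det_neg, det_complexify]
  refine mul_ne_zero (pow_ne_zero _ (neg_ne_zero.2 one_ne_zero)) ?_
  exact_mod_cast hd.1

/-- Eigenvectors for distinct eigenvalues form a basis, orthogonal except between opposite
eigenvalues. It remains to rescale. -/
theorem exists_frame (hm : 2 ≤ m) (hdet : G.det ≠ 0) (hG : G.IsSymm) (hΦ : Φ.transpose = -Φ)
    (hd : NondegenerateDistinct G Φ) : Nonempty (NullDiagonalFrame m G Φ) := by
  classical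
  have h0 := zero_notMem_eigenvalues hdet hd
  obtain ⟨lam, hlam, hhalf, hinj⟩ := exists_eigenvalue_labelling hm hdet hG hΦ hd h0
  have hlam0 : ∀ μ, lam μ ≠ 0 := fun μ h => h0 (h ▸ hlam μ)
  let ε : Fin m ⊕ Fin m → ℂ := Sum.elim (fun μ => -lam μ) lam
  have hεswap : ∀ a, ε a.swap = -ε a := by rintro (a | a) <;> simp [ε]
  have hεinj : Function.Injective ε := by
    refine Function.Injective.sumElim (fun a b h => hinj (neg_injective h)) hinj ?_
    intro a b h
    have h1 := (halfPlane_neg (hlam0 a)).1 (h ▸ hhalf b)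
    exact h1 (hhalf a)
  have hεmem : ∀ a, ε a ∈ eigenvalues G Φ := by
    rintro (a | a)
    · exact neg_mem_eigenvalues hdet hG hΦ (hlam a)
    · exact hlam a
  choose u hu0 hu using fun a => (mem_eigenvalues_iff_exists hdet).1 (hεmem a)
  have horth : ∀ a b, b ≠ a.swap → bilin G (u a) (u b) = 0 := fun a b hb =>
    (hu a).bilin_eq_zero hG hΦ (hu b) fun h => hb (hεinj (by
      rw [hεswap]; linear_combination h))
  have hspan : Submodule.span ℂ (Set.range u) = ⊤ := by
    have hli : LinearIndependent ℂ u :=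
      Module.End.eigenvectors_linearIndependent'
        (Matrix.toLin' (complexify (G⁻¹ * Φ))) ε hεinj u fun a =>
          ⟨Module.End.mem_eigenspace_iff.2 (by
            rw [Matrix.toLin'_apply, (hu a).mulVec_raise hdet]), hu0 a⟩
    exact hli.span_eq_top_of_card_eq_finrank' (by simp [two_mul])
  -- Otherwise `u a` would be orthogonal to the whole eigenbasis, contradicting non-degeneracy.
  have hpair : ∀ a, bilin G (u a) (u a.swap) ≠ 0 := by
    intro a h
    apply hu0 a
    apply bilin_nondeg hdet
    intro v
    have hv : v ∈ Submodule.span ℂ (Set.range u) := hspan ▸ Submodule.mem_top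
    induction hv using Submodule.span_induction with
    | mem x hx =>
      obtain ⟨b, rfl⟩ := hx
      rw [bilin_comm hG]
      by_cases hb : b = a.swap
      · rw [hb, h]
      · exact horth a b hb
    | zero => simp [bilin]
    | add x y _ _ hx hy =>
      rw [bilin_add_left, hx, hy, add_zero]
    | smul c x _ hx => rw [bilin_smul_left, hx, mul_zero]
  -- Rescaling one vector of each pair suffices to normalise the pairing to 1.
  let s : Fin m ⊕ Fin m → ℂ :=
    Sum.elim (fun _ => 1) fun μ => (bilin G (u (Sum.inl μ)) (u (Sum.inr μ)))⁻¹
  let V : Fin m ⊕ Fin m → Fin (2 * m) → ℂ := fun a => s a • u a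
  have hVeig : ∀ a, IsEigen G Φ (ε a) (V a) := fun a => (hu a).smul _
  have hV : ∀ a b, bilin G (V a) (V b) = if b.swap = a then 1 else 0 := by
    intro a b
    simp only [V, bilin_smul_left, bilin_smul_right]
    by_cases h : b.swap = a
    · rw [if_pos h, ← h]
      rcases b with b | b
      · simp only [Sum.swap_inl, s, Sum.elim_inl, Sum.elim_inr, one_mul]
        rw [bilin_comm hG (u (Sum.inr b))]
        exact inv_mul_cancel₀ (hpair (Sum.inl b))
      · simp only [Sum.swap_inr, s, Sum.elim_inl, Sum.elim_inr, one_mul]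
        exact inv_mul_cancel₀ (hpair (Sum.inl b))
    · rw [if_neg h, horth a b fun h' => h (by rw [h', Sum.swap_swap])]
      ring
  let θ : Fin m ⊕ Fin m → Fin (2 * m) → ℂ := fun a => (complexify G).mulVec (V a.swap)
  have hdual : ∀ a b, ∑ i, θ a i * V b i = if a = b then 1 else 0 := by
    intro a b
    have h1 : ∑ i, θ a i * V b i = bilin G (V b) (V a.swap) := by
      rw [bilin_eq, dotProduct_comm]
      rfl
    rw [h1, hV, Sum.swap_swap]
  have hcomp : (Matrix.of V).transpose * (Matrix.of θ) = 1 := by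
    refine (Matrix.mul_eq_one_comm_of_card_eq _ _ _ (by simp [two_mul])).1 ?_
    ext a b
    rw [Matrix.mul_apply, Matrix.one_apply, ← hdual a b]
    rfl
  -- Completeness of the frame: B = ∑ (B V_a) ⊗ θᵃ. For B = g and B = φ this yields the two normal
  -- forms.
  have hexp : ∀ B : Matrix (Fin (2 * m)) (Fin (2 * m)) ℂ, ∀ i j,
      B i j = ∑ a, B.mulVec (V a) i * θ a j := by
    intro B i j
    conv_lhs => rw [← Matrix.mul_one B, ← hcomp, ← Matrix.mul_assoc, Matrix.mul_apply]
    rfl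
  refine ⟨⟨θ, V, fun μ => lam μ, hdual, fun i j => ?_, fun i j => ?_⟩⟩
  · change complexify G i j = _
    rw [hexp (complexify G) i j, Fintype.sum_sum_type, ← Finset.sum_add_distrib]
    refine Finset.sum_congr rfl fun μ _ => ?_
    simp only [θ, Sum.swap_inl, Sum.swap_inr]
    ring
  · change complexify Φ i j = _
    rw [hexp (complexify Φ) i j, Fintype.sum_sum_type, ← Finset.sum_add_distrib]
    refine Finset.sum_congr rfl fun μ _ => ?_
    rw [hVeig, hVeig]
    simp only [θ, ε, Sum.swap_inl, Sum.swap_inr, Sum.elim_inl, Sum.elim_inr, Pi.smul_apply,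
      smul_eq_mul]
    ring

end Existence

/-! ### Lorentzian signature: the real null pair -/

section Lorentzian

variable {m : ℕ} {G Φ : Matrix (Fin (2 * m)) (Fin (2 * m)) ℝ}

/-- A Lorentzian metric has, up to the overall sign `s`, a unit timelike vector, and is negative
definite on the kernel of a time coordinate `T`. -/
theorem IsLorentzian.exists_time {n : ℕ} {G : Matrix (Fin n) (Fin n) ℝ} (hn : 0 < n)
    (h : IsLorentzian G) : ∃ (s : ℝ) (T : (Fin n → ℂ) →ₗ[ℂ] ℂ), s ≠ 0 ∧
      (∃ u, bilin G u (star u) = s) ∧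
      ∀ c, T c = 0 → ∃ r : ℝ, bilin G c (star c) = -s * r ∧ 0 ≤ r ∧ (r = 0 → c = 0) := by
  obtain ⟨s, P, hs, hP, hPG⟩ := h
  have hs0 : s ≠ 0 := by rcases hs with rfl | rfl <;> norm_num
  set i₀ : Fin n := ⟨0, hn⟩
  set D : Fin n → ℝ := fun i => if i.val = 0 then (1 : ℝ) else -1 with hD
  have hinv : complexify P * complexify P⁻¹ = 1 := by
    rw [← complexify_mul, Matrix.mul_nonsing_inv _ (isUnit_iff_ne_zero.2 hP)]
    exact Matrix.map_one _ (by simp) (by simp)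
  -- The real basis `P` that diagonalises `G` also diagonalises the Hermitian form g(u, ū).
  have hval : ∀ y : Fin n → ℂ, bilin G ((complexify P).mulVec y) (star ((complexify P).mulVec y))
      = s * ∑ i, D i * ‖y i‖ ^ 2 := by
    intro y
    have h1 : star ((complexify P).mulVec y) = (complexify P).mulVec (star y) := by
      ext i
      simp [Matrix.mulVec, dotProduct, Complex.conj_ofReal]
    have h2 : (complexify P).transpose * complexify G * complexify P
        = (s : ℂ) • Matrix.diagonal fun i => (D i : ℂ) := by
      have h3 : (complexify P).transpose = complexify P.transpose := Matrix.transpose_map.symm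
      rw [h3, ← complexify_mul, ← complexify_mul, hPG]
      ext i j
      by_cases hij : i = j
      · subst hij; simp
      · simp [hij]
    rw [h1, bilin_eq, ← Matrix.vecMul_transpose, ← Matrix.dotProduct_mulVec,
      Matrix.mulVec_mulVec, Matrix.mulVec_mulVec, h2, Matrix.smul_mulVec,
      dotProduct_smul, smul_eq_mul]
    congr 1
    simp only [dotProduct, Matrix.mulVec_diagonal]
    push_cast
    refine Finset.sum_congr rfl fun i _ => ?_
    have : y i * star (y i) = ((‖y i‖ ^ 2 : ℝ) : ℂ) := by
      rw [Complex.star_def, Complex.mul_conj, Complex.normSq_eq_norm_sq]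
    rw [Pi.star_apply, mul_left_comm, this]
    push_cast
    ring
  have hback : ∀ c : Fin n → ℂ,
      (complexify P).mulVec ((complexify P⁻¹).mulVec c) = c := fun c => by
    rw [Matrix.mulVec_mulVec, hinv, Matrix.one_mulVec]
  refine ⟨s, (LinearMap.proj i₀).comp (complexify P⁻¹).mulVecLin, hs0,
    ⟨(complexify P).mulVec (Pi.single i₀ 1), ?_⟩, fun c hc => ?_⟩
  · rw [hval, Finset.sum_eq_single i₀]
    · simp [hD, i₀]
    · intro j _ hj
      simp [Pi.single_eq_of_ne hj]
    · simp
  · set y := (complexify P⁻¹).mulVec c with hy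
    have hy0 : y i₀ = 0 := hc
    have hterm : ∀ i, D i * ‖y i‖ ^ 2 = -‖y i‖ ^ 2 := by
      intro i
      by_cases hi : i = i₀
      · rw [hi, hy0]; simp
      · have : i.val ≠ 0 := fun h => hi (Fin.ext h)
        simp [hD, this]
    refine ⟨∑ i, ‖y i‖ ^ 2, ?_, Finset.sum_nonneg fun i _ => sq_nonneg _, fun h0 => ?_⟩
    · rw [← hback c, hval]
      have : ∑ i, D i * ‖y i‖ ^ 2 = -∑ i, ‖y i‖ ^ 2 := by
        rw [← Finset.sum_neg_distrib]
        exact Finset.sum_congr rfl fun i _ => hterm i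
      rw [← hy, this]
      push_cast
      ring
    · rw [Finset.sum_eq_zero_iff_of_nonneg fun i _ => sq_nonneg _] at h0
      have : y = 0 := by
        ext i
        simpa using h0 i (Finset.mem_univ i)
      rw [← hback c, ← hy, this, Matrix.mulVec_zero]

/-- In Lorentzian signature two orthogonal null vectors are proportional. -/
theorem IsLorentzian.eq_smul_of_null {n : ℕ} {G : Matrix (Fin n) (Fin n) ℝ} (hG : G.IsSymm)
    (hn : 0 < n) (h : IsLorentzian G) {u w : Fin n → ℂ} (hu0 : u ≠ 0)
    (hu : bilin G u (star u) = 0) (hw : bilin G w (star w) = 0)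
    (huw : bilin G u (star w) = 0) : ∃ c : ℂ, w = c • u := by
  obtain ⟨s, T, hs, -, hT⟩ := h.exists_time hn
  have hs' : (s : ℂ) ≠ 0 := by exact_mod_cast hs
  have hTu : T u ≠ 0 := by
    intro h0
    obtain ⟨r, hr, -, hr'⟩ := hT u h0
    rw [hu] at hr
    apply hu0
    apply hr'
    have := (mul_eq_zero.1 hr.symm).resolve_left (neg_ne_zero.2 hs')
    exact_mod_cast this
  have hwu : bilin G w (star u) = 0 := by
    have := bilin_star G u (star w)
    rw [huw, star_star, star_zero, bilin_comm hG] at this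
    exact this
  -- This combination is isotropic for the Hermitian form and lies in ker T, where that form is
  -- definite; so it is zero, and T u ≠ 0 can be divided out.
  have hc0 : T (T w • u + (-T u) • w) = 0 := by
    simp only [map_add, map_smul, smul_eq_mul]
    ring
  obtain ⟨r, hr, -, hr'⟩ := hT _ hc0
  have hz : bilin G (T w • u + (-T u) • w) (star (T w • u + (-T u) • w)) = 0 := by
    rw [star_add, star_smul, star_smul, bilin_add_left, bilin_add_right, bilin_add_right]
    simp only [bilin_smul_left, bilin_smul_right, hu, hw, huw, hwu]
    ring
  rw [hz] at hr
  have h1 := (mul_eq_zero.1 hr.symm).resolve_left (neg_ne_zero.2 hs')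
  have h2 := hr' (by exact_mod_cast h1)
  refine ⟨(T u)⁻¹ * T w, ?_⟩
  have h3 : T w • u = T u • w := by
    rw [neg_smul, ← sub_eq_add_neg, sub_eq_zero] at h2
    exact h2
  rw [← smul_smul, h3, smul_smul, inv_mul_cancel₀ hTu, one_smul]

/-- The real part of `v` is (1 + c)/2 times `v`. It spans the direction unless c = -1, in which case
`v` is purely imaginary. -/
theorem isRealDirection_of_star {n : ℕ} {v : Fin n → ℂ} {c : ℂ} (hv : v ≠ 0)
    (h : star v = c • v) : IsRealDirection v := by
  have hre : ∀ i, ((v i).re : ℂ) = (1 + c) / 2 * v i := by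
    intro i
    have h1 : (starRingEnd ℂ) (v i) = c * v i := congrFun h i
    have h2 := Complex.add_conj (v i)
    rw [h1] at h2
    push_cast at h2
    linear_combination -h2 / 2
  by_cases hc : 1 + c = 0
  · refine ⟨Complex.I, fun i => (v i).im, Complex.I_ne_zero, ?_, ?_⟩
    · intro h0
      apply hv
      ext i
      have h1 := hre i
      rw [hc, zero_div, zero_mul] at h1
      exact Complex.ext (by exact_mod_cast h1) (congrFun h0 i)
    · ext i
      have h1 := hre i
      rw [hc, zero_div, zero_mul] at h1
      have h2 : (v i).re = 0 := by exact_mod_cast h1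
      rw [Pi.smul_apply, smul_eq_mul, toComplex]
      exact Complex.ext (by simp [h2]) (by simp)
  · refine ⟨2 / (1 + c), fun i => (v i).re, div_ne_zero two_ne_zero hc, ?_, ?_⟩
    · intro h0
      apply hv
      ext i
      have h1 := hre i
      rw [congrFun h0 i] at h1
      have h2 : (1 + c) / 2 * v i = 0 := by rw [← h1]; simp
      exact (mul_eq_zero.1 h2).resolve_left (div_ne_zero hc two_ne_zero)
    · ext i
      rw [Pi.smul_apply, smul_eq_mul, toComplex, hre i]
      field_simp

namespace NullDiagonalFrame

variable (F : NullDiagonalFrame m G Φ)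

/-- The conjugate of V_a has the conjugate eigenvalue, and α + ᾱ = 2 Re α. -/
theorem bilin_star_self_of_re_ne_zero (hG : G.IsSymm) (hΦ : Φ.transpose = -Φ)
    {a : Fin m ⊕ Fin m} (ha : (F.ev a).re ≠ 0) : bilin G (F.V a) (star (F.V a)) = 0 := by
  refine (F.isEigen a).bilin_eq_zero hG hΦ (F.isEigen a).star ?_
  rw [Complex.add_conj]
  exact_mod_cast mul_ne_zero two_ne_zero ha

theorem star_eq_smul (hm : 2 ≤ m) (hG : G.IsSymm) (hΦ : Φ.transpose = -Φ)
    (hL : IsLorentzian G) {a : Fin m ⊕ Fin m} (ha : (F.ev a).re ≠ 0) :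
    ∃ c : ℂ, star (F.V a) = c • F.V a := by
  have h0 := F.bilin_star_self_of_re_ne_zero hG hΦ ha
  refine hL.eq_smul_of_null hG (by omega) (F.V_ne_zero a) h0 ?_ ?_
  · rw [star_star, bilin_comm hG, h0]
  · rw [star_star, F.bilin_V_self]

/-- A second such vector outside the pair of `a` would be orthogonal to V_a and Hermitian-null,
hence a multiple of V_a; but it has product 1 with its partner, to which V_a is orthogonal. -/
theorem re_eq_zero_of_ne (hm : 2 ≤ m) (hG : G.IsSymm) (hΦ : Φ.transpose = -Φ)
    (hL : IsLorentzian G) {a b : Fin m ⊕ Fin m} (ha : (F.ev a).re ≠ 0) (hb : b ≠ a)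
    (hb' : b ≠ a.swap) : (F.ev b).re = 0 := by
  by_contra hre
  obtain ⟨c, hc⟩ := F.star_eq_smul hm hG hΦ hL hre
  obtain ⟨d, hd⟩ := hL.eq_smul_of_null hG (by omega) (F.V_ne_zero a)
    (F.bilin_star_self_of_re_ne_zero hG hΦ ha) (F.bilin_star_self_of_re_ne_zero hG hΦ hre)
    (by rw [hc, bilin_smul_right, bilin_V, if_neg fun h => hb' (by rw [← h, Sum.swap_swap]),
      mul_zero])
  have h1 := F.bilin_V b.swap b
  rw [if_pos rfl, hd, bilin_smul_right, bilin_V, if_neg, mul_zero] at h1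
  · exact zero_ne_one h1
  · intro h
    exact hb (Function.Involutive.injective Sum.swap_swap h).symm

/-- If all eigenvalues were imaginary, distinct frame vectors would be Hermitian-orthogonal. The
diagonal entries, divided by s, are then all ≤ 0, leaving no room for a timelike vector. -/
theorem exists_re_ne_zero (hm : 2 ≤ m) (hdet : G.det ≠ 0) (hG : G.IsSymm)
    (hΦ : Φ.transpose = -Φ) (hd : NondegenerateDistinct G Φ) (hL : IsLorentzian G) :
    ∃ a, (F.ev a).re ≠ 0 := by
  by_contra! hre
  obtain ⟨s, T, hs, ⟨u, hu⟩, hT⟩ := hL.exists_time (by omega)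
  have hs' : (s : ℂ) ≠ 0 := by exact_mod_cast hs
  have hconj : ∀ a, (starRingEnd ℂ) (F.ev a) = -F.ev a := fun a =>
    Complex.ext (by simp [hre a]) (by simp)
  have horth : ∀ a b, b ≠ a → bilin G (F.V a) (star (F.V b)) = 0 := by
    intro a b hb
    refine (F.isEigen a).bilin_eq_zero hG hΦ (F.isEigen b).star ?_
    rw [hconj]
    intro h
    exact hb (F.ev_injective hdet hG hd (by linear_combination -h))
  have hreal : ∀ a, ∃ r : ℝ, bilin G (F.V a) (star (F.V a)) = s * r := by
    intro a
    have h1 := bilin_star G (F.V a) (star (F.V a))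
    rw [star_star, bilin_comm hG] at h1
    obtain ⟨t, ht⟩ := Complex.conj_eq_iff_real.1 h1.symm
    exact ⟨t / s, by rw [ht]; push_cast; field_simp⟩
  choose h hh using hreal
  -- Since g(v, v) = 0, `v` and its conjugate are Hermitian-orthogonal of equal norm. A positive
  -- norm would make the form positive on their span, but some combination of them lies in ker T,
  -- where the form is negative; if its coefficients vanish, `v` itself lies there.
  have hneg : ∀ a, h a ≤ 0 := by
    intro a
    by_contra! hpos
    set v := F.V a
    have hc0 : T (T (star v) • v + (-T v) • star v) = 0 := by
      simp only [map_add, map_smul, smul_eq_mul]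
      ring
    obtain ⟨r, hr, hr0, -⟩ := hT _ hc0
    have hz : bilin G (T (star v) • v + (-T v) • star v)
        (star (T (star v) • v + (-T v) • star v))
        = s * (‖T (star v)‖ ^ 2 + ‖T v‖ ^ 2) * h a := by
      have e0 : bilin G v (star v) = s * h a := hh a
      have e1 : bilin G v v = 0 := F.bilin_V_self a
      have e2 : bilin G (star v) (star v) = 0 := by rw [bilin_star, e1, star_zero]
      have e3 : bilin G (star v) v = s * h a := by rw [bilin_comm hG, e0]
      rw [star_add, star_smul, star_smul, star_star, bilin_add_left, bilin_add_right,
        bilin_add_right]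
      simp only [bilin_smul_left, bilin_smul_right, e0, e1, e2, e3]
      have n1 : ∀ z : ℂ, z * star z = (‖z‖ : ℂ) ^ 2 := fun z => Complex.mul_conj' z
      rw [star_neg, ← n1, ← n1]
      ring
    rw [hz] at hr
    have e4 : ((‖T (star v)‖ ^ 2 + ‖T v‖ ^ 2) * h a : ℝ) = -r := by
      have : (s : ℂ) * (((‖T (star v)‖ ^ 2 + ‖T v‖ ^ 2) * h a : ℝ) : ℂ) = s * ((-r : ℝ) : ℂ) := by
        push_cast
        linear_combination hr
      exact_mod_cast mul_left_cancel₀ hs' this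
    have e5 : ‖T v‖ ^ 2 = 0 := by nlinarith [sq_nonneg ‖T (star v)‖, sq_nonneg ‖T v‖]
    have e6 : T v = 0 := by simpa using e5
    obtain ⟨r', hr', hr0', -⟩ := hT v e6
    rw [hh a] at hr'
    have e7 : h a = -r' := by
      have : (s : ℂ) * (h a : ℂ) = s * ((-r' : ℝ) : ℂ) := by
        push_cast
        linear_combination hr'
      exact_mod_cast mul_left_cancel₀ hs' this
    linarith
  set x : Fin m ⊕ Fin m → ℂ := fun a => bilin G (F.V a.swap) u
  have hsum : bilin G u (star u) = ∑ a, (s : ℂ) * ((‖x a‖ : ℂ) ^ 2 * (h a : ℂ)) := by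
    have h1 : u = ∑ a, x a • F.V a := F.expand hG u
    have h2 : star u = ∑ a, star (x a) • star (F.V a) := by
      conv_lhs => rw [h1]
      rw [star_sum]
      exact Finset.sum_congr rfl fun a _ => star_smul _ _
    rw [h2]
    conv_lhs => rw [h1]
    rw [bilin_sum_left]
    refine Finset.sum_congr rfl fun a _ => ?_
    rw [bilin_sum_right, Finset.sum_eq_single a]
    · have n1 : x a * star (x a) = (‖x a‖ : ℂ) ^ 2 := Complex.mul_conj' _
      rw [hh a, ← n1]
      ring
    · intro b _ hb
      rw [horth a b hb, mul_zero]
    · simp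
  rw [hu, ← Finset.mul_sum] at hsum
  have h3 : (1 : ℝ) = ∑ a, ‖x a‖ ^ 2 * h a := by
    have : (s : ℂ) * ((1 : ℝ) : ℂ) = s * ((∑ a, ‖x a‖ ^ 2 * h a : ℝ) : ℂ) := by
      push_cast
      rw [mul_one]
      exact hsum
    exact_mod_cast mul_left_cancel₀ hs' this
  have h4 : ∑ a, ‖x a‖ ^ 2 * h a ≤ 0 := Finset.sum_nonpos fun a _ =>
    mul_nonpos_of_nonneg_of_nonpos (sq_nonneg _) (hneg a)
  linarith

variable {W : Fin (2 * m) → Fin (2 * m) → Fin (2 * m) → Fin (2 * m) → ℝ}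

/-- After the antisymmetries remove b = a and c = d, at most one of `c`, `d` equals `a`. All other
eigenvalues are imaginary, so the sum has real part Re α_a or 2 Re α_a. -/
theorem aligned_of_re_ne_zero (hm : 2 ≤ m) (hdet : G.det ≠ 0) (hG : G.IsSymm)
    (hΦ : Φ.transpose = -Φ) (hL : IsLorentzian G)
    (hW : ∀ a b c d, tensorAct (G⁻¹ * Φ) W a b c d = 0)
    (h1 : ∀ a b c d, W a b c d = -W b a c d) (h2 : ∀ a b c d, W a b c d = -W a b d c)
    {a : Fin m ⊕ Fin m} (ha : (F.ev a).re ≠ 0) : F.Aligned W a := by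
  intro b c d hb hc hd
  have key : ∀ b, b ≠ a.swap → b ≠ a → (F.ev b).re = 0 := fun b h h' =>
    F.re_eq_zero_of_ne hm hG hΦ hL ha h' h
  by_cases hba : b = a
  · rw [hba]; exact quad_eq_zero_fst _ _ _ h1
  by_cases hcd : c = d
  · rw [hcd]; exact quad_eq_zero_snd _ _ _ h2
  refine quad_eigen hdet hW (F.isEigen a) (F.isEigen b) (F.isEigen c) (F.isEigen d) ?_
  intro h
  have hre := congrArg Complex.re h
  simp only [Complex.add_re, Complex.zero_re, key b hb hba] at hre
  by_cases hca : c = a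
  · rw [hca, key d hd fun h => hcd (by rw [hca, h])] at hre
    exact ha (by linarith)
  · rw [key c hc hca] at hre
    by_cases hda : d = a
    · rw [hda] at hre
      exact ha (by linarith)
    · rw [key d hd hda] at hre
      exact ha (by linarith)

/-- A real eigenvector has a real eigenvalue, and no eigenvalue is zero. -/
theorem re_ne_zero_of_isRealDirection (hdet : G.det ≠ 0) (hG : G.IsSymm)
    (hd : NondegenerateDistinct G Φ) {a : Fin m ⊕ Fin m} (h : IsRealDirection (F.V a)) :
    (F.ev a).re ≠ 0 := by
  obtain ⟨c, l, hc, hl, hV⟩ := h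
  have h1 : IsEigen G Φ (F.ev a) (toComplex l) := by
    have := (F.isEigen a).smul c⁻¹
    rwa [hV, smul_smul, inv_mul_cancel₀ hc, one_smul] at this
  have h2 : star (toComplex l) = toComplex l := by
    ext i
    simp [toComplex]
  have h3 := h1.star
  rw [h2] at h3
  have h4 : ((starRingEnd ℂ) (F.ev a) - F.ev a) • toComplex l = 0 := by
    rw [sub_smul, ← h3.mulVec_raise hdet, ← h1.mulVec_raise hdet, sub_self]
  have h5 : toComplex l ≠ 0 := by
    intro h
    apply hl
    ext i
    have := congrFun h i
    simpa [toComplex] using this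
  have h6 := (smul_eq_zero.1 h4).resolve_right h5
  obtain ⟨r, hr⟩ := Complex.conj_eq_iff_real.1 (sub_eq_zero.1 h6)
  intro h0
  apply F.ev_ne_zero hdet hG hd a
  rw [hr] at h0 ⊢
  rw [Complex.ofReal_re] at h0
  rw [h0, Complex.ofReal_zero]

end NullDiagonalFrame

theorem isTypeDPair_rescale {n : ℕ} {G : Matrix (Fin n) (Fin n) ℝ}
    {W : Fin n → Fin n → Fin n → Fin n → ℝ} {u v : Fin n → ℂ} (h : IsTypeDPair G W u v)
    {c : ℂ} (hc : c ≠ 0) : IsTypeDPair G W (c • u) (c⁻¹ • v) := by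
  have key : ∀ (u v : Fin n → ℂ) (c d : ℂ), c ≠ 0 → d ≠ 0 → NoPositiveBoost G W u v →
      NoPositiveBoost G W (c • u) (d • v) := by
    intro u v c d hc hd h X Y Z h1 h2 h3 h4 h5 h6
    simp only [bilin_smul_left, mul_eq_zero, hc, hd, false_or] at h1 h2 h3 h4 h5 h6
    obtain ⟨q1, q2, q3⟩ := h X Y Z h1 h2 h3 h4 h5 h6
    have s1 := quad_smul W u X u Y c 1 c 1
    have s2 := quad_smul W u v u X c d c 1
    have s3 := quad_smul W u X Y Z c 1 1 1
    simp only [one_smul] at s1 s2 s3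
    rw [s1, s2, s3, q1, q2, q3]
    simp
  obtain ⟨h1, h2, h3, h4, h5⟩ := h
  refine ⟨?_, ?_, ?_, key _ _ _ _ hc (inv_ne_zero hc) h4, key _ _ _ _ (inv_ne_zero hc) hc h5⟩
  · rw [bilin_smul_left, bilin_smul_right, h1]; ring
  · rw [bilin_smul_left, bilin_smul_right, h2]; ring
  · rw [bilin_smul_left, bilin_smul_right, h3, mul_one, mul_inv_cancel₀ hc]

theorem IsTypeDPair.isTypeD {n : ℕ} {G : Matrix (Fin n) (Fin n) ℝ}
    {W : Fin n → Fin n → Fin n → Fin n → ℝ} {u v : Fin n → ℂ} (hW : W ≠ 0)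
    (h : IsTypeDPair G W u v) (hu : IsRealDirection u) (hv : IsRealDirection v) :
    IsTypeD G W := by
  obtain ⟨c, l, hc, -, rfl⟩ := hu
  obtain ⟨d, k, hd, -, rfl⟩ := hv
  have hr : ∀ l k : Fin n → ℝ, ∃ r : ℝ, bilin G (toComplex l) (toComplex k) = r := fun l k =>
    ⟨∑ i, ∑ j, G i j * l i * k j, by simp [bilin, toComplex]⟩
  obtain ⟨r, hr⟩ := hr l k
  have h1 := h.2.2.1
  rw [bilin_smul_left, bilin_smul_right, hr] at h1
  have hr0 : (r : ℂ) ≠ 0 := by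
    rintro h0
    rw [h0] at h1
    simp at h1
  -- The normalisation c d g(l, k) = 1 with g(l, k) = r real makes c d real, so moving both factors
  -- onto `k` keeps the pair real and normalised.
  have hcd : c * d = ((r⁻¹ : ℝ) : ℂ) := by
    push_cast
    rw [← mul_eq_one_iff_eq_inv₀ hr0, ← h1]
    ring
  refine ⟨hW, l, r⁻¹ • k, ?_⟩
  have h2 := isTypeDPair_rescale h (inv_ne_zero hc)
  rw [smul_smul, inv_mul_cancel₀ hc, one_smul, inv_inv, smul_smul, hcd] at h2
  convert h2 using 1
  ext i
  simp [toComplex]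

end Lorentzian

/-! ### Simple eigenvalues on two-forms and passage to the closure -/

section Closure

variable {m : ℕ}

namespace NullDiagonalFrame

variable {G Φ : Matrix (Fin (2 * m)) (Fin (2 * m)) ℝ}

/-- Stated for arbitrary eigenvectors instead of a frame, so that it can be used along a sequence of
points without choosing frames compatibly. -/
theorem quad_eq_zero_of_simple (F : NullDiagonalFrame m G Φ)
    {W : Fin (2 * m) → Fin (2 * m) → Fin (2 * m) → Fin (2 * m) → ℝ}
    (hdet : G.det ≠ 0) (hG : G.IsSymm) (hΦ : Φ.transpose = -Φ)
    (hd : NondegenerateDistinct G Φ) (hW : ∀ a b c d, tensorAct (G⁻¹ * Φ) W a b c d = 0)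
    (h1 : ∀ a b c d, W a b c d = -W b a c d) (h2 : ∀ a b c d, W a b c d = -W a b d c)
    (hS : SimpleOnTwoForms G Φ) {α β γ δ : ℂ} {u v w z : Fin (2 * m) → ℂ}
    (hα : α ∈ eigenvalues G Φ) (hβ : β ∈ eigenvalues G Φ) (hγ : γ ∈ eigenvalues G Φ)
    (hδ : δ ∈ eigenvalues G Φ) (hu : IsEigen G Φ α u) (hv : IsEigen G Φ β v)
    (hw : IsEigen G Φ γ w) (hz : IsEigen G Φ δ z) (hαβ : α + β ≠ 0) (hαγ : α + γ ≠ 0)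
    (hαδ : α + δ ≠ 0) : quad W u v w z = 0 := by
  have hprop : ∀ {α : ℂ} {u v : Fin (2 * m) → ℂ}, α ∈ eigenvalues G Φ → IsEigen G Φ α u →
      IsEigen G Φ α v → ∃ (a : Fin m ⊕ Fin m) (c d : ℂ), u = c • F.V a ∧ v = d • F.V a := by
    intro α u v hα hu hv
    rw [F.eigenvalues_eq hdet hG] at hα
    obtain ⟨a, rfl⟩ := hα
    obtain ⟨c, hc⟩ := F.isEigen_eq_smul hdet hG hΦ hd hu
    obtain ⟨d, hd⟩ := F.isEigen_eq_smul hdet hG hΦ hd hv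
    exact ⟨a, c, d, hc, hd⟩
  by_cases hab : α = β
  · subst hab
    obtain ⟨a, c, d, rfl, rfl⟩ := hprop hα hu hv
    have s := quad_smul W (F.V a) (F.V a) w z c d 1 1
    rw [one_smul, one_smul, quad_eq_zero_fst _ _ _ h1, mul_zero] at s
    exact s
  by_cases hcd : γ = δ
  · subst hcd
    obtain ⟨a, c, d, rfl, rfl⟩ := hprop hγ hw hz
    have s := quad_smul W u v (F.V a) (F.V a) 1 1 c d
    rw [one_smul, one_smul, quad_eq_zero_snd _ _ _ h2, mul_zero] at s
    exact s
  -- If the sum vanishes, then α + β = (-γ) + (-δ) ≠ 0, and simplicity forces α = -γ or α = -δ.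
  refine quad_eigen hdet hW hu hv hw hz fun h0 => ?_
  rcases hS α hα β hβ (-γ) (neg_mem_eigenvalues hdet hG hΦ hγ) (-δ)
    (neg_mem_eigenvalues hdet hG hΦ hδ) hab (fun h => hcd (neg_injective h)) hαβ
    (by linear_combination h0) with h | h
  · exact hαγ (by rw [h.1, neg_add_cancel])
  · exact hαδ (by rw [h.1, neg_add_cancel])

theorem det_pencil (F : NullDiagonalFrame m G Φ) (ε : ℂ) :
    (ε • complexify G - complexify Φ).det = G.det * ∏ a, (ε - F.ev a) := by
  classical
  let e : Fin (2 * m) ≃ Fin m ⊕ Fin m := Fintype.equivOfCardEq (by simp [two_mul])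
  let Q : Matrix (Fin (2 * m)) (Fin (2 * m)) ℂ := Matrix.of fun i j => F.V (e j) i
  let R : Matrix (Fin (2 * m)) (Fin (2 * m)) ℂ := Matrix.of fun j i => F.θ (e j) i
  have hRQ : R * Q = 1 := by
    ext i j
    rw [Matrix.mul_apply, Matrix.one_apply]
    simp only [← e.injective.eq_iff (a := i) (b := j), ← F.dual]
    rfl
  have hQ : Q.det ≠ 0 := by
    intro h
    have := congrArg Matrix.det hRQ
    rw [Matrix.det_mul, h, mul_zero, Matrix.det_one] at this
    exact zero_ne_one this
  have hmul : (ε • complexify G - complexify Φ) * Q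
      = complexify G * Q * Matrix.diagonal fun j => ε - F.ev (e j) := by
    ext i j
    rw [Matrix.mul_diagonal]
    change ((ε • complexify G - complexify Φ).mulVec (F.V (e j))) i
      = (complexify G).mulVec (F.V (e j)) i * _
    rw [Matrix.sub_mulVec, Matrix.smul_mulVec, F.isEigen (e j)]
    simp only [Pi.sub_apply, Pi.smul_apply, smul_eq_mul]
    ring
  have h := congrArg Matrix.det hmul
  rw [Matrix.det_mul, Matrix.det_mul, Matrix.det_mul, Matrix.det_diagonal, det_complexify,
    e.prod_comp fun a => ε - F.ev a] at h
  exact mul_right_cancel₀ hQ (by rw [h]; ring)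

/-- If all 2m eigenvalues were at distance at least `r` from ε, the factorisation `det_pencil` would
bound the determinant below. With continuity of the determinant this gives continuity of the
eigenvalues. -/
theorem exists_eigenvalue_near (F : NullDiagonalFrame m G Φ) (hdet : G.det ≠ 0)
    (hG : G.IsSymm) {ε : ℂ} {r : ℝ} (hr : 0 < r)
    (h : ‖(ε • complexify G - complexify Φ).det‖ < ‖G.det‖ * r ^ (2 * m)) :
    ∃ α ∈ eigenvalues G Φ, ‖ε - α‖ < r := by
  by_contra! hc
  have h1 : r ^ (2 * m) ≤ ∏ a, ‖ε - F.ev a‖ := by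
    calc r ^ (2 * m) = ∏ _a : Fin m ⊕ Fin m, r := by simp [two_mul]
      _ ≤ _ := Finset.prod_le_prod (fun _ _ => hr.le) fun a _ =>
          hc _ (by rw [F.eigenvalues_eq hdet hG]; exact ⟨a, rfl⟩)
  rw [F.det_pencil, norm_mul, norm_prod, Complex.norm_real] at h
  exact absurd h (not_lt.2 (mul_le_mul_of_nonneg_left h1 (norm_nonneg _)))

end NullDiagonalFrame

theorem tendsto_complexify_mulVec {n : ℕ} {ι : Type*} {l : Filter ι}
    {B : ι → Matrix (Fin n) (Fin n) ℝ} {B₀ : Matrix (Fin n) (Fin n) ℝ} {u : ι → Fin n → ℂ}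
    {u₀ : Fin n → ℂ} (hB : ∀ i j, Filter.Tendsto (fun k => B k i j) l (nhds (B₀ i j)))
    (hu : Filter.Tendsto u l (nhds u₀)) (i : Fin n) :
    Filter.Tendsto (fun k => (complexify (B k)).mulVec (u k) i) l
      (nhds ((complexify B₀).mulVec u₀ i)) := by
  simp only [Matrix.mulVec, dotProduct, Matrix.map_apply]
  exact tendsto_finsetSum _ fun j _ =>
    ((Complex.continuous_ofReal.tendsto _).comp (hB i j)).mul (tendsto_pi_nhds.1 hu j)

theorem tendsto_quad {n : ℕ} {ι : Type*} {l : Filter ι}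
    {W : ι → Fin n → Fin n → Fin n → Fin n → ℝ} {W₀ : Fin n → Fin n → Fin n → Fin n → ℝ}
    {u v w z : ι → Fin n → ℂ} {u₀ v₀ w₀ z₀ : Fin n → ℂ}
    (hW : ∀ a b c d, Filter.Tendsto (fun k => W k a b c d) l (nhds (W₀ a b c d)))
    (hu : Filter.Tendsto u l (nhds u₀)) (hv : Filter.Tendsto v l (nhds v₀))
    (hw : Filter.Tendsto w l (nhds w₀)) (hz : Filter.Tendsto z l (nhds z₀)) :
    Filter.Tendsto (fun k => quad (W k) (u k) (v k) (w k) (z k)) l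
      (nhds (quad W₀ u₀ v₀ w₀ z₀)) := by
  simp only [quad]
  exact tendsto_finsetSum _ fun a _ => tendsto_finsetSum _ fun b _ =>
    tendsto_finsetSum _ fun c _ => tendsto_finsetSum _ fun d _ =>
      (((((Complex.continuous_ofReal.tendsto _).comp (hW a b c d)).mul
        (tendsto_pi_nhds.1 hu a)).mul (tendsto_pi_nhds.1 hv b)).mul
        (tendsto_pi_nhds.1 hw c)).mul (tendsto_pi_nhds.1 hz d)

variable {U : Set (Coord (2 * m))} {G Φ : Coord (2 * m) → Matrix (Fin (2 * m)) (Fin (2 * m)) ℝ}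
  {x : Coord (2 * m)}

theorem weyl_antisymm (h : LocalCKY U G Φ) (hx : x ∈ U) :
    (∀ a b c d, weyl G x a b c d = -weyl G x b a c d) ∧
      ∀ a b c d, weyl G x a b c d = -weyl G x a b d c := by
  constructor
  · intro a b c d
    rw [weyl_eq h, weyl_eq h, riemann_antisymm_left h.isOpen h.smoothG h.det h.symm hx]
    simp only [kulkarniNomizu]
    ring
  · intro a b c d
    rw [weyl_eq h, weyl_eq h, riemann_antisymm_right]
    simp only [kulkarniNomizu]
    ring

theorem MSmooth.tendsto (h : MSmooth U G) (hU : IsOpen U) (hx : x ∈ U) (i j : Fin (2 * m)) :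
    Filter.Tendsto (fun y => G y i j) (nhds x) (nhds (G x i j)) :=
  (h.diff hU hx i j).continuousAt

/-- Each eigenvalue at `x` is approximated by eigenvalues at the points near `x`. -/
theorem eventually_exists_eigenvalue_near (hm : 2 ≤ m) (h : LocalCKY U G Φ)
    (hd : ∀ y ∈ U, NondegenerateDistinct (G y) (Φ y)) (hx : x ∈ U) {ε : ℂ}
    (hε : ε ∈ eigenvalues (G x) (Φ x)) {r : ℝ} (hr : 0 < r) :
    ∀ᶠ y in nhds x, ∃ α ∈ eigenvalues (G y) (Φ y), ‖ε - α‖ < r := by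
  have hdet : Filter.Tendsto (fun y => ‖(ε • complexify (G y) - complexify (Φ y)).det‖) (nhds x)
      (nhds ‖(ε • complexify (G x) - complexify (Φ x)).det‖) := by
    simp only [Matrix.det_apply']
    refine (tendsto_finsetSum _ fun σ _ => tendsto_const_nhds.mul
      (tendsto_finsetProd _ fun i _ => ?_)).norm
    exact (tendsto_const_nhds.mul ((Complex.continuous_ofReal.tendsto _).comp
      (h.smoothG.tendsto h.isOpen hx _ _))).sub
      ((Complex.continuous_ofReal.tendsto _).comp (h.smoothΦ.tendsto h.isOpen hx _ _))
  rw [(mem_eigenvalues_iff (h.det x hx)).1 hε, norm_zero] at hdet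
  have hG : Filter.Tendsto (fun y => ‖(G y).det‖ * r ^ (2 * m)) (nhds x)
      (nhds (‖(G x).det‖ * r ^ (2 * m))) :=
    ((ContDiffOn.differentiableAt_of_isOpen h.isOpen h.smoothG.det
      hx).continuousAt.norm.mul_const _)
  have hpos : 0 < ‖(G x).det‖ * r ^ (2 * m) :=
    mul_pos (norm_pos_iff.2 (h.det x hx)) (pow_pos hr _)
  filter_upwards [hdet.eventually_lt hG hpos, h.isOpen.mem_nhds hx] with y hy hyU
  obtain ⟨F⟩ := exists_frame hm (h.det y hyU) (h.symm y hyU) (h.alt y hyU) (hd y hyU)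
  exact F.exists_eigenvalue_near (h.det y hyU) (h.symm y hyU) hr hy

theorem exists_unit_eigen {n : ℕ} {G Φ : Matrix (Fin n) (Fin n) ℝ} (hdet : G.det ≠ 0) {α : ℂ}
    (hα : α ∈ eigenvalues G Φ) : ∃ u, ‖u‖ = 1 ∧ IsEigen G Φ α u := by
  obtain ⟨u, hu0, hu⟩ := (mem_eigenvalues_iff_exists hdet).1 hα
  refine ⟨((‖u‖⁻¹ : ℝ) : ℂ) • u, ?_, hu.smul _⟩
  rw [norm_smul, Complex.norm_real, norm_inv, norm_norm,
    inv_mul_cancel₀ (norm_ne_zero_iff.2 hu0)]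

theorem aligned_of_mem_closure (hm : 2 ≤ m) (h : LocalCKY U G Φ)
    (hd : ∀ y ∈ U, NondegenerateDistinct (G y) (Φ y)) (hx : x ∈ U)
    (hcl : x ∈ closure {y | y ∈ U ∧ SimpleOnTwoForms (G y) (Φ y)})
    (F : NullDiagonalFrame m (G x) (Φ x)) (a : Fin m ⊕ Fin m) :
    F.Aligned (weyl G x) a := by
  have hev : ∀ a, F.ev a ∈ eigenvalues (G x) (Φ x) := fun a => by
    rw [F.eigenvalues_eq (h.det x hx) (h.symm x hx)]
    exact ⟨a, rfl⟩
  -- Points of N tending to `x`, together with eigenvalues there tending to each eigenvalue of the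
  -- frame at `x`.
  have hstep : ∀ k : ℕ, ∃ y, dist y x < 1 / ((k : ℝ) + 1) ∧ y ∈ U ∧
      SimpleOnTwoForms (G y) (Φ y) ∧ ∀ b, ∃ α ∈ eigenvalues (G y) (Φ y),
        ‖F.ev b - α‖ < 1 / ((k : ℝ) + 1) := by
    intro k
    have hk : (0 : ℝ) < 1 / ((k : ℝ) + 1) := Nat.one_div_pos_of_nat
    have hnear : ∀ᶠ y in nhds x, ∀ b, ∃ α ∈ eigenvalues (G y) (Φ y),
        ‖F.ev b - α‖ < 1 / ((k : ℝ) + 1) :=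
      Filter.eventually_all.2 fun b => eventually_exists_eigenvalue_near hm h hd hx (hev b) hk
    obtain ⟨y, ⟨hyU, hyS⟩, hyb, hyd⟩ := ((mem_closure_iff_frequently.1 hcl).and_eventually
      (hnear.and (Metric.ball_mem_nhds x hk))).exists
    exact ⟨y, hyd, hyU, hyS, hyb⟩
  choose y hyd hyU hyS α hα hαd using hstep
  choose u hu1 hu using fun k b => exists_unit_eigen (h.det (y k) (hyU k)) (hα k b)
  have hone := tendsto_one_div_add_atTop_nhds_zero_nat (𝕜 := ℝ)
  have hy : Filter.Tendsto y Filter.atTop (nhds x) :=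
    tendsto_iff_dist_tendsto_zero.2
      (squeeze_zero (fun _ => dist_nonneg) (fun k => (hyd k).le) hone)
  have hαt : ∀ b, Filter.Tendsto (fun k => α k b) Filter.atTop (nhds (F.ev b)) := fun b =>
    tendsto_iff_dist_tendsto_zero.2
      (squeeze_zero (fun _ => dist_nonneg)
        (fun k => by rw [dist_comm, dist_eq_norm]; exact (hαd k b).le) hone)
  -- Eigenvectors need not vary continuously; compactness of the unit ball gives a common
  -- subsequence along which all converge.
  obtain ⟨u₀, -, ψ, hψ, hu₀⟩ :=
    (isCompact_closedBall (0 : Fin m ⊕ Fin m → Fin (2 * m) → ℂ) 1).tendsto_subseq (x := u)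
      fun k => by
        rw [mem_closedBall_zero_iff, pi_norm_le_iff_of_nonneg zero_le_one]
        exact fun b => (hu1 k b).le
  have hut : ∀ b, Filter.Tendsto (fun k => u (ψ k) b) Filter.atTop (nhds (u₀ b)) :=
    tendsto_pi_nhds.1 hu₀
  have hyψ := hy.comp hψ.tendsto_atTop
  have hαψ := fun b => (hαt b).comp hψ.tendsto_atTop
  have hne : ∀ b, u₀ b ≠ 0 := by
    intro b h0
    have h1 := (hut b).norm
    simp only [hu1, h0, norm_zero] at h1
    exact one_ne_zero (tendsto_nhds_unique tendsto_const_nhds h1)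
  have heig : ∀ b, IsEigen (G x) (Φ x) (F.ev b) (u₀ b) := by
    intro b
    ext i
    refine tendsto_nhds_unique (tendsto_complexify_mulVec
      (fun i j => (h.smoothΦ.tendsto h.isOpen hx i j).comp hyψ) (hut b) i) ?_
    refine ((hαψ b).mul (tendsto_complexify_mulVec
      (fun i j => (h.smoothG.tendsto h.isOpen hx i j).comp hyψ) (hut b) i)).congr fun k => ?_
    exact (congrFun (hu (ψ k) b) i).symm
  -- The limits are eigenvectors at `x`, where eigenvalues are simple, so each is a non-zero
  -- multiple of a frame vector.
  choose t ht using fun b =>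
    F.isEigen_eq_smul (h.det x hx) (h.symm x hx) (h.alt x hx) (hd x hx) (heig b)
  have ht0 : ∀ b, t b ≠ 0 := fun b h0 => hne b (by rw [ht b, h0, zero_smul])
  intro b c d hb hc hd'
  -- Non-vanishing of α_a + α_b is an open condition, so it passes from `x` to the tail of the
  -- sequence.
  have hsum : ∀ b, b ≠ a.swap → ∀ᶠ k in Filter.atTop, α (ψ k) a + α (ψ k) b ≠ 0 := fun b hb =>
    ((hαψ a).add (hαψ b)).eventually_ne
      (F.ev_add_ne_zero (h.det x hx) (h.symm x hx) (hd x hx) hb)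
  have hlim := tendsto_quad (W := fun k => weyl G (y (ψ k)))
    (fun i j k l => ((ContDiffOn.differentiableAt_of_isOpen h.isOpen
      (contDiffOn_weyl h.isOpen h.smoothG h.det i j k l) hx).continuousAt.tendsto.comp hyψ))
    (hut a) (hut b) (hut c) (hut d)
  have hzero : ∀ᶠ k in Filter.atTop,
      quad (weyl G (y (ψ k))) (u (ψ k) a) (u (ψ k) b) (u (ψ k) c) (u (ψ k) d) = 0 := by
    filter_upwards [hsum b hb, hsum c hc, hsum d hd'] with k h1 h2 h3
    have hk := hyU (ψ k)
    obtain ⟨F'⟩ := exists_frame hm (h.det _ hk) (h.symm _ hk) (h.alt _ hk) (hd _ hk)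
    exact F'.quad_eq_zero_of_simple (h.det _ hk) (h.symm _ hk) (h.alt _ hk) (hd _ hk)
      (tensorAct_weyl h hk) (weyl_antisymm h hk).1 (weyl_antisymm h hk).2 (hyS (ψ k))
      (hα _ _) (hα _ _) (hα _ _) (hα _ _) (hu _ _) (hu _ _) (hu _ _) (hu _ _) h1 h2 h3
  have h0 := tendsto_nhds_unique (hlim.congr' hzero) tendsto_const_nhds
  rw [ht a, ht b, ht c, ht d, quad_smul] at h0
  exact (mul_eq_zero.1 h0).resolve_left
    (mul_ne_zero (mul_ne_zero (mul_ne_zero (ht0 a) (ht0 b)) (ht0 c)) (ht0 d))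

end Closure

/-! ### Transfer from the manifold to a chart -/

section Global

variable {m : ℕ} {M : Type*} [TopologicalSpace M] [ChartedSpace (Coord (2 * m)) M]

theorem IsConformalKillingYano.localCKY (hm : 2 ≤ m) {g : Metric (2 * m) M}
    {φ : TwoForm (2 * m) M} (hφ : IsConformalKillingYano g φ)
    {e : OpenPartialHomeomorph M (Coord (2 * m))} (he : e ∈ atlas (Coord (2 * m)) M)
    (hdist : ∀ x ∈ e.target, NondegenerateDistinct (comp g.form e x) (comp φ.form e x)) :
    LocalCKY e.target (comp g.form e) (comp φ.form e) where
  dim := by omega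
  isOpen := e.open_target
  smoothG := g.smooth e he
  smoothΦ := φ.smooth e he
  symm y _ := by
    ext i j
    exact g.symm _ _ _
  det y hy := NullDiagonalFrame.det_ne_zero_of_distinct hm (hdist y hy)
  alt y _ := by
    ext i j
    have h : ∀ X Y, φ.form (e.symm y) X Y = -φ.form (e.symm y) Y X := by
      intro X Y
      have h1 := φ.alt (e.symm y) (X + Y)
      simp only [map_add, LinearMap.add_apply, φ.alt, zero_add, add_zero] at h1
      linarith
    exact h _ _
  cky y hy := hφ e he y hy

end Global

end CKY

end

theorem mainTheorem4 (m : ℕ) (hm : 2 ≤ m) {M : Type*} [TopologicalSpace M]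
    [ChartedSpace (CKY.Coord (2 * m)) M] [IsManifold (𝓡 (2 * m)) ∞ M]
    (g : CKY.Metric (2 * m) M) (φ : CKY.TwoForm (2 * m) M)
    (hφ : CKY.IsConformalKillingYano g φ)
    (hdist : ∀ e ∈ atlas (CKY.Coord (2 * m)) M, ∀ x ∈ e.target,
      CKY.NondegenerateDistinct (CKY.comp g.form e x) (CKY.comp φ.form e x))
    (e : OpenPartialHomeomorph M (CKY.Coord (2 * m)))
    (he : e ∈ atlas (CKY.Coord (2 * m)) M)
    (x : CKY.Coord (2 * m)) (hx : x ∈ e.target) :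
    -- arbitrary signature, all vectors of the complex null frame
    (x ∈ closure {y | y ∈ e.target ∧
        CKY.SimpleOnTwoForms (CKY.comp g.form e y) (CKY.comp φ.form e y)} →
      ∀ F : CKY.NullDiagonalFrame m (CKY.comp g.form e x) (CKY.comp φ.form e x),
        (∀ a, CKY.IsWAND (CKY.comp g.form e x) (CKY.weyl (CKY.comp g.form e) x) (F.V a)) ∧
        (∀ μ, CKY.IsTypeDPair (CKY.comp g.form e x) (CKY.weyl (CKY.comp g.form e) x)
          (F.V (Sum.inl μ)) (F.V (Sum.inr μ)))) ∧
    -- Lorentzian signature, real null directions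
    (CKY.IsLorentzian (CKY.comp g.form e x) →
      (∀ F : CKY.NullDiagonalFrame m (CKY.comp g.form e x) (CKY.comp φ.form e x),
        (∃ μ, CKY.IsRealDirection (F.V (Sum.inl μ)) ∧ CKY.IsRealDirection (F.V (Sum.inr μ)) ∧
          CKY.IsTypeDPair (CKY.comp g.form e x) (CKY.weyl (CKY.comp g.form e) x)
            (F.V (Sum.inl μ)) (F.V (Sum.inr μ))) ∧
        (∀ a, CKY.IsRealDirection (F.V a) →
          CKY.IsWAND (CKY.comp g.form e x) (CKY.weyl (CKY.comp g.form e) x) (F.V a))) ∧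
      (CKY.weyl (CKY.comp g.form e) x = 0 ∨
        CKY.IsTypeD (CKY.comp g.form e x) (CKY.weyl (CKY.comp g.form e) x))) := by
  have h := hφ.localCKY hm he (hdist e he)
  have hd := hdist e he
  have hdet := h.det x hx
  have hG := h.symm x hx
  have hΦ := h.alt x hx
  have hW := CKY.tensorAct_weyl h hx
  obtain ⟨hA, hA'⟩ := CKY.weyl_antisymm h hx
  refine ⟨fun hcl F => ?_, fun hL => ?_⟩
  · have hF := CKY.aligned_of_mem_closure hm h hd hx hcl F
    exact ⟨fun a => (hF a).isWAND hG,
      fun μ => (hF (Sum.inl μ)).isTypeDPair (hF _) hdet hG (hd x hx) hW⟩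
  · have hpair : ∀ F : CKY.NullDiagonalFrame m (CKY.comp g.form e x) (CKY.comp φ.form e x),
        ∃ μ, CKY.IsRealDirection (F.V (Sum.inl μ)) ∧ CKY.IsRealDirection (F.V (Sum.inr μ)) ∧
          CKY.IsTypeDPair (CKY.comp g.form e x) (CKY.weyl (CKY.comp g.form e) x)
            (F.V (Sum.inl μ)) (F.V (Sum.inr μ)) := by
      intro F
      obtain ⟨a, ha⟩ := F.exists_re_ne_zero hm hdet hG hΦ (hd x hx) hL
      -- Dual vectors have opposite eigenvalues, so both members of the pair have non-zero real
      -- part.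
      obtain ⟨μ, hμ⟩ : ∃ μ, (F.ev (Sum.inl μ)).re ≠ 0 := by
        rcases a with μ | μ
        · exact ⟨μ, ha⟩
        · refine ⟨μ, ?_⟩
          rw [← Sum.swap_inr, F.ev_swap, Complex.neg_re]
          exact neg_ne_zero.2 ha
      have hμ' : (F.ev (Sum.inl μ).swap).re ≠ 0 := by
        rw [F.ev_swap, Complex.neg_re]
        exact neg_ne_zero.2 hμ
      have hreal : ∀ a, (F.ev a).re ≠ 0 → CKY.IsRealDirection (F.V a) := by
        intro a ha
        obtain ⟨c, hc⟩ := F.star_eq_smul hm hG hΦ hL ha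
        exact CKY.isRealDirection_of_star (F.V_ne_zero a) hc
      exact ⟨μ, hreal _ hμ, hreal _ hμ',
        (F.aligned_of_re_ne_zero hm hdet hG hΦ hL hW hA hA' hμ).isTypeDPair
          (F.aligned_of_re_ne_zero hm hdet hG hΦ hL hW hA hA' hμ') hdet hG (hd x hx) hW⟩
    refine ⟨fun F => ⟨hpair F, fun a ha => ?_⟩, ?_⟩
    · exact (F.aligned_of_re_ne_zero hm hdet hG hΦ hL hW hA hA'
        (F.re_ne_zero_of_isRealDirection hdet hG (hd x hx) ha)).isWAND hG
    · by_cases h0 : CKY.weyl (CKY.comp g.form e) x = 0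
      · exact Or.inl h0
      -- The type D claim mentions no frame, so one has to be constructed.
      · obtain ⟨F⟩ := CKY.exists_frame hm hdet hG hΦ (hd x hx)
        obtain ⟨μ, h1, h2, h3⟩ := hpair F
        exact Or.inr (h3.isTypeD h0 h1 h2)
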